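/- **Setting.** Let $\xi$ be a random vector in $\mathbb{R}^d$ on a probability space $(\Omega,\mathcal F,\mathcal P)$, let $f:\mathbb{R}\times\mathbb{R}^n\times\mathbb{R}^m\times\mathbb{R}^d\to\mathbb{R}^n$, $g:\mathbb{R}\times\mathbb{R}^n\times\mathbb{R}^m\times\mathbb{R}^d\to\mathbb{R}$, $A:\mathbb{R}^d\to\mathbb{R}^{q\times n}$, $B:\mathbb{R}^d\to\mathbb{R}^{q\times m}$, $Q:\mathbb{R}\times\mathbb{R}^d\to\mathbb{R}^q$ and $x_0\in\mathbb{R}^n$ be given, and consider $$\dot x(t)=\mathbb{E}[f(t,x(t),y(t),\xi)],\quad x(0)=x_0,\qquad y(t)\in\mathcal S(t,x(t)):=\arg\min_{\mathbf y\in K(t,x(t))}\mathbb{E}[g(t,x(t),\mathbf y,\xi)],\tag{1}$$ $$K(t,\mathbf x)=\{\mathbf y\in\mathbb{R}^m:\ \mathbb{E}[A(\xi)]\mathbf x+\mathbb{E}[B(\xi)]\mathbf y+\mathbb{E}[Q(t,\xi)]\le 0\}.$$ A pair $(x,y)$ is a *weak solution* of (1) over $[0,T]$ if $x$ is absolutely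 continuous and $y$ is integrable on $[0,T]$, and $y(t)\in\mathcal S(t,x(t))$ and $x(t)=x_0+\int_0^t\mathbb{E}[f(\tau,x(\tau),y(\tau),\xi)]\,d\tau$ for all $t\in[0,T]$. Assume, for $t\ge 0$: all the expected values above are well defined (the integrands are integrable functions of $\xi$); there is an integrable $\kappa_f(\xi)\ge 0$ such that for a.e. $\xi$ the function $f(\cdot,\cdot,\cdot,\xi)$ satisfies $\|f(t_1,u_1,v_1,\xi)-f(t_2,u_2,v_2,\xi)\|\le\kappa_f(\xi)(|t_1-t_2|+\|u_1-u_2\|+\|v_1-v_2\|)$; for a.e. $\xi$ the function $g(t,\mathbf x,\cdot,\xi)$ is convex for all $t,\mathbf x$, and $g(\cdot,\cdot,\cdot,\xi)$ and $Q(\cdot,\xi)$ are continuous; there is an integrable $\kappa_Q(\xi)\ge0$ with $\|Q(t,\xi)\|\le\kappa_Q(\xi)t$ for a.e. $\xi$ and all $t\ge0$; and on every bounded set of $(t,\mathbf x,\mathbf y)$ the functions $|g(t,\mathbf x,\mathbf y,\cdot)|$ are dominated by an integrable function of $\xi$. **Assumption 1.** $\operatorname{int}K(0,x_0)\ne\emptyset$;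 for every $\alpha\in\mathbb{R}$ the set $\{\mathbf y\in K(0,x_0):\mathbb{E}[g(0,x_0,\mathbf y,\xi)]\le\alpha\}$ is bounded; and for a.e. $\xi$ the map $f(t,\mathbf x,\cdot,\xi)$ is affine for all $t\ge 0$, $\mathbf x\in\mathbb{R}^n$. Assume also that every constraint whose row in $\mathbb{E}[B(\xi)]$ is zero holds with strict inequality at $(0,x_0)$, i.e. $(\mathbb{E}[A(\xi)]x_0+\mathbb{E}[Q(0,\xi)])_i<0$ whenever the $i$-th row of $\mathbb{E}[B(\xi)]$ vanishes. **Regularized sample average approximation.** Let $\xi_1,\xi_2,\dots$ be i.i.d. copies of $\xi$, and let $\tilde\rho:\mathbb{R}^d\to(0,\infty)$ be measurable with $\mathbb{E}[\tilde\rho(\xi)]<\infty$. For $\mu>0$ and $\nu\ge1$ consider the problem $$\dot x(t)=\frac1\nu\sum_{\ell=1}^\nu f(t,x(t),y(t),\xi_\ell),\quad x(0)=x_0,$$ $$y(t)=\arg\min_{\mathbf y\in K^\nu(t,x(t))}\ \frac1\nu\sum_{\ell=1}^\nu g(t,x(t),\mathbf y,\xi_\ell)+\frac{\mu}{2\nu}\sum_{\ell=1}^\nu\tilde\rho(\xi_\ell)\|\mathbf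 y\|^2,$$ where $K^\nu(t,\mathbf x)=\{\mathbf y:\frac1\nu\sum_{\ell=1}^\nu(A(\xi_\ell)\mathbf x+B(\xi_\ell)\mathbf y+Q(t,\xi_\ell))\le0\}$. Let $T_0>0$, and suppose that for every $\mu>0$, with probability 1, for all sufficiently large $\nu$ (depending on the sample path), $(x_\mu^\nu,y_\mu^\nu)\in C^1([0,T_0])\times C^0([0,T_0])$ solves this problem on $[0,T_0]$. **Theorem.** There is a (deterministic) $\check T\in(0,T_0]$ such that, with probability 1, there exist (depending on the sample path) an absolutely continuous $x^*:[0,\check T]\to\mathbb{R}^n$, a function $y^*\in L^2([0,\check T];\mathbb{R}^m)$, a strictly decreasing sequence $\mu_k\downarrow0$ of positive numbers and a sequence $\nu_j\to\infty$ of natural numbers such that $$\lim_{k\to\infty}\lim_{j\to\infty}\ \sup_{t\in[0,\check T]}\|x_{\mu_k}^{\nu_j}(t)-x^*(t)\|=0,$$ $$\lim_{k\to\infty}\lim_{j\to\infty}\int_0^{\check T}\langle y_{\mu_k}^{\nu_j}(t),h(t)\rangle\,dt=\int_0^{\check T}\langle y^*(t),h(t)\rangle\,dt\quad\text{for all }h\in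 L^2([0,\check T];\mathbb{R}^m)$$ (all these iterated limits exist), and, if moreover $\lim_{k\to\infty}\lim_{j\to\infty}\|y_{\mu_k}^{\nu_j}-y^*\|_{L^2([0,\check T])}=0$, then $(x^*,y^*)$ is a weak solution of (1) over $[0,\check T]$. -/

import Mathlib

open MeasureTheory ProbabilityTheory Filter Topology Set

noncomputable section

/-- `ℝᵏ` with the Euclidean norm. -/
abbrev Vec (k : ℕ) : Type := EuclideanSpace ℝ (Fin k)

/-- The data of a dynamic system coupled with a stochastic convex program:
`ẋ(t) = 𝔼[f(t, x(t), y(t), ξ)]`, `x(0) = x₀`, where `y(t)` minimizes `𝔼[g(t, x(t), ·, ξ)]`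
subject to `𝔼[A(ξ)] x(t) + 𝔼[B(ξ)] y + 𝔼[Q(t, ξ)] ≤ 0`. -/
structure OCDE (n m q d : ℕ) where
  f : ℝ → Vec n → Vec m → Vec d → Vec n
  g : ℝ → Vec n → Vec m → Vec d → ℝ
  A : Vec d → Matrix (Fin q) (Fin n) ℝ
  B : Vec d → Matrix (Fin q) (Fin m) ℝ
  Q : ℝ → Vec d → Vec q
  x₀ : Vec n

namespace OCDE

variable {n m q d : ℕ} (D : OCDE n m q d)

/-! In this section `π` is the law of the random vector `ξ`, so that `𝔼[h(ξ)] = ∫ z, h z ∂π`. -/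

section Expected

variable (π : Measure (Vec d))

/-- `𝔼[f(t, x, y, ξ)]`. -/
def Ef (t : ℝ) (x : Vec n) (y : Vec m) : Vec n := ∫ z, D.f t x y z ∂π

/-- `𝔼[g(t, x, y, ξ)]`. -/
def Eg (t : ℝ) (x : Vec n) (y : Vec m) : ℝ := ∫ z, D.g t x y z ∂π

/-- `𝔼[A(ξ)]`. -/
def EA : Matrix (Fin q) (Fin n) ℝ := Matrix.of fun i j => ∫ z, D.A z i j ∂π

/-- `𝔼[B(ξ)]`. -/
def EB : Matrix (Fin q) (Fin m) ℝ := Matrix.of fun i j => ∫ z, D.B z i j ∂π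

/-- `𝔼[Q(t, ξ)]`. -/
def EQ (t : ℝ) : Vec q := ∫ z, D.Q t z ∂π

/-- The feasible set `K(t, x)`. -/
def K (t : ℝ) (x : Vec n) : Set (Vec m) :=
  {y | ∀ i, ((D.EA π).mulVec x.ofLp) i + ((D.EB π).mulVec y.ofLp) i + D.EQ π t i ≤ 0}

/-- The optimal solution set `S(t, x)` of the stochastic convex program. -/
def S (t : ℝ) (x : Vec n) : Set (Vec m) :=
  {y | y ∈ D.K π t x ∧ ∀ y' ∈ D.K π t x, D.Eg π t x y ≤ D.Eg π t x y'}

/-- The standing assumptions on the data. -/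
structure Standing : Prop where
  /-- all expected values are well defined -/
  integrable_f : ∀ t, 0 ≤ t → ∀ x y, Integrable (D.f t x y) π
  integrable_g : ∀ t, 0 ≤ t → ∀ x y, Integrable (D.g t x y) π
  integrable_A : ∀ i j, Integrable (fun z => D.A z i j) π
  integrable_B : ∀ i j, Integrable (fun z => D.B z i j) π
  integrable_Q : ∀ t, 0 ≤ t → Integrable (D.Q t) π
  /-- `f` is Lipschitz in `(t, x, y)` with an integrable Lipschitz modulus -/
  lipschitz_f : ∃ κ : Vec d → ℝ, Measurable κ ∧ (∀ z, 0 ≤ κ z) ∧ Integrable κ π ∧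
    ∀ᵐ z ∂π, ∀ t₁ t₂, 0 ≤ t₁ → 0 ≤ t₂ → ∀ (u₁ u₂ : Vec n) (v₁ v₂ : Vec m),
      ‖D.f t₁ u₁ v₁ z - D.f t₂ u₂ v₂ z‖ ≤ κ z * (|t₁ - t₂| + ‖u₁ - u₂‖ + ‖v₁ - v₂‖)
  /-- `g` is convex in `y` -/
  convex_g : ∀ᵐ z ∂π, ∀ t, 0 ≤ t → ∀ x : Vec n, ConvexOn ℝ univ (fun y => D.g t x y z)
  /-- `g` is continuous in `(t, x, y)` -/
  continuous_g : ∀ᵐ z ∂π,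
    ContinuousOn (fun p : ℝ × Vec n × Vec m => D.g p.1 p.2.1 p.2.2 z) (Ici 0 ×ˢ univ)
  /-- `Q` is continuous in `t` -/
  continuous_Q : ∀ᵐ z ∂π, ContinuousOn (fun t => D.Q t z) (Ici 0)
  /-- `Q` grows at most linearly in `t`, with an integrable factor -/
  bound_Q : ∃ κ : Vec d → ℝ, Measurable κ ∧ (∀ z, 0 ≤ κ z) ∧ Integrable κ π ∧
    ∀ᵐ z ∂π, ∀ t, 0 ≤ t → ‖D.Q t z‖ ≤ κ z * t
  /-- on every bounded set of `(t, x, y)`, `g` is dominated by an integrable function of `ξ` -/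
  dominated_g : ∀ R : ℝ, ∃ κ : Vec d → ℝ, Integrable κ π ∧
    ∀ᵐ z ∂π, ∀ t, 0 ≤ t → t ≤ R → ∀ (x : Vec n) (y : Vec m), ‖x‖ ≤ R → ‖y‖ ≤ R →
      |D.g t x y z| ≤ κ z

/-- The interior point, level-boundedness and affinity assumption. -/
structure InteriorAssumption : Prop where
  interior_nonempty : (interior (D.K π 0 D.x₀)).Nonempty
  levelBounded : ∀ α : ℝ, Bornology.IsBounded {y ∈ D.K π 0 D.x₀ | D.Eg π 0 D.x₀ y ≤ α}
  affine_f : ∀ᵐ z ∂π, ∀ t, 0 ≤ t → ∀ x : Vec n,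
    ∃ L : Vec m →ᵃ[ℝ] Vec n, ∀ y, D.f t x y z = L y

/-- A constraint in which `y` does not occur (its row of `𝔼[B(ξ)]` is zero) is not active
at `(0, x₀)`. -/
def NoActiveTrivialRow : Prop :=
  ∀ i, (∀ j, D.EB π i j = 0) → ((D.EA π).mulVec D.x₀.ofLp) i + D.EQ π 0 i < 0

/-- `(x, y)` is a weak solution over `[0, T]`. -/
structure IsWeakSolution (T : ℝ) (x : ℝ → Vec n) (y : ℝ → Vec m) : Prop where
  absolutelyContinuous : AbsolutelyContinuousOnInterval x 0 T
  integrable : IntegrableOn y (Icc 0 T)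
  optimal : ∀ t ∈ Icc 0 T, y t ∈ D.S π t (x t)
  integral_eq : ∀ t ∈ Icc 0 T, x t = D.x₀ + ∫ τ in (0 : ℝ)..t, D.Ef π τ (x τ) (y τ)

end Expected

/-! In this section `s 0, s 1, …` is a realization of the sample `ξ₁, ξ₂, …`, and `ν` is the
sample size. -/

section Sample

variable (s : ℕ → Vec d) (ν : ℕ)

/-- `ν⁻¹ ∑ f(t, x, y, ξ_ℓ)`. -/
def saaF (t : ℝ) (x : Vec n) (y : Vec m) : Vec n :=
  (ν : ℝ)⁻¹ • ∑ l ∈ Finset.range ν, D.f t x y (s l)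

/-- The feasible set `K^ν(t, x)`. -/
def saaK (t : ℝ) (x : Vec n) : Set (Vec m) :=
  {y | ∀ i, (ν : ℝ)⁻¹ * ∑ l ∈ Finset.range ν,
    (((D.A (s l)).mulVec x.ofLp) i + ((D.B (s l)).mulVec y.ofLp) i + D.Q t (s l) i) ≤ 0}

/-- The regularized objective `ν⁻¹ ∑ g(t, x, y, ξ_ℓ) + (μ / (2ν)) ∑ ρ(ξ_ℓ) ‖y‖²`. -/
def saaObj (ρ : Vec d → ℝ) (μ : ℝ) (t : ℝ) (x : Vec n) (y : Vec m) : ℝ :=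
  (ν : ℝ)⁻¹ * ∑ l ∈ Finset.range ν, D.g t x y (s l)
    + μ / (2 * ν) * ∑ l ∈ Finset.range ν, ρ (s l) * ‖y‖ ^ 2

/-- `(x, y) ∈ C¹([0, T]) × C⁰([0, T])` solves the regularized sample average approximation
on `[0, T]`. -/
structure IsSAASolution (ρ : Vec d → ℝ) (μ T : ℝ) (x : ℝ → Vec n) (y : ℝ → Vec m) : Prop where
  contDiffOn : ContDiffOn ℝ 1 x (Icc 0 T)
  continuousOn : ContinuousOn y (Icc 0 T)
  initial : x 0 = D.x₀
  deriv_eq : ∀ t ∈ Icc 0 T, HasDerivWithinAt x (D.saaF s ν t (x t) (y t)) (Icc 0 T) t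
  feasible : ∀ t ∈ Icc 0 T, y t ∈ D.saaK s ν t (x t)
  optimal : ∀ t ∈ Icc 0 T, ∀ y' ∈ D.saaK s ν t (x t),
    D.saaObj s ν ρ μ t (x t) (y t) ≤ D.saaObj s ν ρ μ t (x t) y'

end Sample

end OCDE

/-- `‖u‖_s = sup_{t ∈ [0, T]} ‖u(t)‖`. -/
def supNorm {k : ℕ} (T : ℝ) (u : ℝ → Vec k) : ℝ := ⨆ t : Icc (0 : ℝ) T, ‖u t‖

/-- `‖v‖_{L²} = (∫₀ᵀ ‖v(t)‖² dt)^{1/2}`. -/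
def l2Norm {k : ℕ} (T : ℝ) (v : ℝ → Vec k) : ℝ := √(∫ t in (0 : ℝ)..T, ‖v t‖ ^ 2)

/-- The iterated limit `lim_{k → ∞} lim_{j → ∞} a k j` exists and equals `L`. -/
def IteratedLimit (a : ℕ → ℕ → ℝ) (L : ℝ) : Prop :=
  ∃ b : ℕ → ℝ, (∀ k, Tendsto (a k) atTop (𝓝 (b k))) ∧ Tendsto b atTop (𝓝 L)

/-- `v k j` converges to `w` weakly in `L²([0, T]; ℝᵐ)` in the iterated limit, first `j → ∞` and
then `k → ∞`. -/
def IteratedWeakLimit {m : ℕ} (T : ℝ) (v : ℕ → ℕ → ℝ → Vec m) (w : ℝ → Vec m) : Prop :=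
  ∀ h : ℝ → Vec m, MemLp h 2 (volume.restrict (Icc 0 T)) →
    IteratedLimit (fun k j => ∫ t in (0 : ℝ)..T, inner ℝ (v k j t) (h t))
      (∫ t in (0 : ℝ)..T, inner ℝ (w t) (h t))

end

/-! Randomness enters only through a strong law of large numbers in the Banach space of continuous
functions on a compact box: almost surely the sample averages of `f`, `g` and the constraints
converge uniformly on every box (`uniform_strong_law`). The rest is deterministic, along one such
sample.

A priori bounds (`exists_barrier`, `exists_bounds`). With a Slater point `y₀` and bounded level sets
at `(0, x₀)`, some sphere around `y₀` consists of points that are infeasible or clearly worse than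
`y₀`. This persists for `(t, x)` near `(0, x₀)` and for large samples, and convexity then traps the
minimizers inside the sphere. Hence velocities are bounded, and trajectories stay near `x₀` on an
interval whose length does not depend on the sample.

Compactness (`exists_iterated_subseq`). Arzelà–Ascoli for `x` and Banach–Alaoglu for `y` give the
two nested limits.

Identification (`ApproxSeq.mem_S`, `ApproxSeq.integral_eq`). Under strong convergence, a diagonal
sequence has `y` converging almost everywhere. Limits of minimizers are minimizers, because the
Slater point allows any feasible competitor to be approximated by points feasible for the samples;
the integral equation passes to the limit by dominated convergence. Optimality at every time, not
just almost every one, comes from changing `y*` on a null set, which is possible since the limiting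
solution sets are nonempty. -/

open MeasureTheory ProbabilityTheory Filter Topology Set

noncomputable section

/-! ### Uniform strong law of large numbers. -/

section UniformLaw

variable {X Z E : Type*} [MetricSpace X] [SecondCountableTopology X] [MeasurableSpace Z]
  [NormedAddCommGroup E] [NormedSpace ℝ E] [CompleteSpace E] [SecondCountableTopology E]

omit [NormedSpace ℝ E] in
/-- A family of continuous functions on a compact space that depends measurably on a parameter
pointwise is strongly measurable as a map into the space of continuous functions. -/
theorem aestronglyMeasurable_continuousMap_of_eval [CompactSpace X] {π : Measure Z}
    (Φ : Z → C(X, E)) (h : ∀ p, AEStronglyMeasurable (fun z => Φ z p) π) :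
    AEStronglyMeasurable Φ π := by
  borelize E C(X, E)
  obtain ⟨S, hSc, hSd⟩ := TopologicalSpace.exists_countable_dense X
  have : Countable S := hSc.to_subtype
  let e : C(X, E) → (S → E) := fun u p => u p
  have hec : Continuous e := by
    refine continuous_pi fun p => ?_
    fun_prop
  have hei : Function.Injective e := by
    intro u v huv
    refine DFunLike.coe_injective (Continuous.ext_on hSd u.continuous v.continuous ?_)
    intro p hp
    exact congrFun huv ⟨p, hp⟩
  have : PolishSpace C(X, E) := inferInstance
  -- Lusin–Souslin: a continuous injection out of a Polish space is a measurable embedding, so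
  -- measurability of `Φ` can be tested on countably many evaluations.
  have hme := hec.measurableEmbedding hei
  have : AEMeasurable (e ∘ Φ) π := by
    rw [aemeasurable_pi_iff]
    exact fun p => (h p).aemeasurable
  exact ((hme.aemeasurable_comp_iff).1 this).aestronglyMeasurable

/-- Uniform strong law of large numbers on a compact set of parameters. -/
theorem uniform_strong_law {Ω : Type*} [MeasurableSpace Ω] {P : Measure Ω}
    {ξ : Ω → Z} {ξs : ℕ → Ω → Z} (hindep : iIndepFun ξs P)
    (hident : ∀ l, IdentDistrib (ξs l) ξ P P) {K : Set X} (hK : IsCompact K) (F : X → Z → E)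
    (hint : ∀ p ∈ K, Integrable (F p) (P.map ξ))
    (hcont : ∀ᵐ z ∂P.map ξ, ContinuousOn (fun p => F p z) K)
    {κ : Z → ℝ} (hκ : Integrable κ (P.map ξ))
    (hbound : ∀ᵐ z ∂P.map ξ, ∀ p ∈ K, ‖F p z‖ ≤ κ z) :
    ContinuousOn (fun p => ∫ z, F p z ∂P.map ξ) K ∧
      ∀ᵐ ω ∂P, TendstoUniformlyOn
        (fun (ν : ℕ) p => (ν : ℝ)⁻¹ • ∑ l ∈ Finset.range ν, F p (ξs l ω))
        (fun p => ∫ z, F p z ∂P.map ξ) atTop K := by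
  have : CompactSpace K := isCompact_iff_compactSpace.1 hK
  borelize C(K, E)
  set π := P.map ξ with hπ
  -- The value 0 is taken for the null set of `z` at which `F · z` is not continuous on `K`.
  let Φ : Z → C(K, E) := fun z => ContinuousMap.mkD (K.domRestrict fun p => F p z) 0
  have hΦ : ∀ᵐ z ∂π, ∀ p : K, Φ z p = F p z := by
    filter_upwards [hcont] with z hz p
    exact ContinuousMap.mkD_apply_of_continuousOn hz
  have hΦm : AEStronglyMeasurable Φ π := by
    refine aestronglyMeasurable_continuousMap_of_eval Φ fun p => ?_
    refine (hint p p.2).aestronglyMeasurable.congr ?_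
    filter_upwards [hΦ] with z hz using (hz p).symm
  have hΦi : Integrable Φ π :=
    ⟨hΦm, ContinuousMap.hasFiniteIntegral_mkD_restrict_of_bound (fun z p => F p z) 0 hcont κ
      hκ.hasFiniteIntegral hbound⟩
  have hmap : ∀ l, P.map (ξs l) = π := fun l => (hident l).map_eq
  -- `Φ` is measurable only up to a null set of the law; a genuinely measurable version is needed to
  -- transfer independence and equality of laws to the composites with `ξs l`.
  let Ψ := hΦm.mk Φ
  have hΨm : StronglyMeasurable Ψ := hΦm.stronglyMeasurable_mk
  have hΨ : ∀ᵐ z ∂π, Ψ z = Φ z := hΦm.ae_eq_mk.symm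
  have hΨi : Integrable Ψ π := hΦi.congr hΦm.ae_eq_mk
  have hIΦ : ∀ p : K, (∫ z, Ψ z ∂π) p = ∫ z, F p z ∂π := by
    intro p
    -- Evaluation is continuous and linear, so the Bochner integral in `C(K, E)` is the pointwise
    -- expectation; continuity of the expectation follows.
    have := (ContinuousMap.evalCLM ℝ p).integral_comp_comm hΨi
    simp only [ContinuousMap.evalCLM_apply] at this
    rw [← this]
    refine integral_congr_ae ?_
    filter_upwards [hΨ, hΦ] with z h1 h2
    rw [h1, h2]
  constructor
  · rw [continuousOn_iff_continuous_domRestrict]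
    convert (∫ z, Ψ z ∂π).continuous using 1
    ext p
    exact (hIΦ p).symm
  · have hid : ∀ l, IdentDistrib (fun ω => Ψ (ξs l ω)) (fun ω => Ψ (ξs 0 ω)) P P := fun l =>
      ((hident l).trans (hident 0).symm).comp hΨm.measurable
    have hind : Pairwise fun i j => IndepFun (fun ω => Ψ (ξs i ω)) (fun ω => Ψ (ξs j ω)) P :=
      fun i j hij => (hindep.indepFun hij).comp hΨm.measurable hΨm.measurable
    have hi0 : Integrable (fun ω => Ψ (ξs 0 ω)) P := by
      have h0 := hΨi
      rw [← hmap 0] at h0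
      exact h0.comp_aemeasurable (hident 0).aemeasurable_fst
    have hE : ∫ ω, Ψ (ξs 0 ω) ∂P = ∫ z, Ψ z ∂π := by
      rw [← hmap 0, integral_map (hident 0).aemeasurable_fst hΨm.aestronglyMeasurable]
    have hall : ∀ᵐ ω ∂P, ∀ l (p : K), Ψ (ξs l ω) p = F p (ξs l ω) := by
      rw [ae_all_iff]
      intro l
      refine ae_of_ae_map (p := fun z => ∀ p : K, Ψ z p = F p z) (hident l).aemeasurable_fst ?_
      rw [hmap l]
      filter_upwards [hΨ, hΦ] with z h1 h2 p
      rw [h1, h2]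
    have hlim := strong_law_ae (fun l ω => Ψ (ξs l ω)) hi0 hind hid
    filter_upwards [hlim, hall] with ω h1 h2
    rw [hE, ContinuousMap.tendsto_iff_tendstoUniformly] at h1
    rw [tendstoUniformlyOn_iff_tendstoUniformly_comp_coe]
    convert h1 using 1
    · ext ν p
      simp [h2]
    · ext p
      exact (hIΦ p).symm

end UniformLaw

/-! ### Majorants and continuity of the data on boxes. -/

namespace OCDE

variable {n m q d : ℕ} (D : OCDE n m q d)

/-- The set of all `(t, x, y)` with `0 ≤ t ≤ R`, `‖x‖ ≤ R` and `‖y‖ ≤ R`. -/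
def box (n m : ℕ) (R : ℝ) : Set (ℝ × Vec n × Vec m) :=
  Icc 0 R ×ˢ Metric.closedBall 0 R ×ˢ Metric.closedBall 0 R

theorem mem_box {R t : ℝ} {x : Vec n} {y : Vec m} :
    (t, x, y) ∈ box n m R ↔ (0 ≤ t ∧ t ≤ R) ∧ ‖x‖ ≤ R ∧ ‖y‖ ≤ R := by
  simp [box]

theorem isCompact_box (R : ℝ) : IsCompact (box n m R) :=
  isCompact_Icc.prod ((isCompact_closedBall _ _).prod (isCompact_closedBall _ _))

/-- Every point with `t ≥ 0` has a relative neighbourhood inside a box of integer radius, so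
countably many boxes suffice. -/
theorem continuousOn_of_box {E : Type*} [TopologicalSpace E] {h : ℝ × Vec n × Vec m → E}
    (hh : ∀ R : ℕ, ContinuousOn h (box n m R)) : ContinuousOn h (Ici 0 ×ˢ univ) := by
  rintro ⟨t, x, y⟩ ⟨ht, -⟩
  obtain ⟨R, hR⟩ := exists_nat_gt (max (max |t| ‖x‖) ‖y‖)
  have hR1 : |t| < R := lt_of_le_of_lt (by simp) hR
  have hR2 : ‖x‖ < R := lt_of_le_of_lt (by simp) hR
  have hR3 : ‖y‖ < R := lt_of_le_of_lt (by simp) hR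
  have hc := hh R (t, x, y) (mem_box.2 ⟨⟨ht, ((le_abs_self t).trans hR1.le)⟩, hR2.le, hR3.le⟩)
  refine hc.mono_of_mem_nhdsWithin ?_
  have hU : {p : ℝ × Vec n × Vec m | |p.1| < R ∧ ‖p.2.1‖ < R ∧ ‖p.2.2‖ < R} ∈ 𝓝 (t, x, y) := by
    refine IsOpen.mem_nhds ?_ ⟨hR1, hR2, hR3⟩
    have h1 : Continuous fun p : ℝ × Vec n × Vec m => |p.1| := by fun_prop
    have h2 : Continuous fun p : ℝ × Vec n × Vec m => ‖p.2.1‖ := by fun_prop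
    have h3 : Continuous fun p : ℝ × Vec n × Vec m => ‖p.2.2‖ := by fun_prop
    exact (isOpen_lt h1 continuous_const).inter
      ((isOpen_lt h2 continuous_const).inter (isOpen_lt h3 continuous_const))
  filter_upwards [mem_nhdsWithin_of_mem_nhds hU, self_mem_nhdsWithin] with p hp hp0
  obtain ⟨t', x', y'⟩ := p
  exact mem_box.2 ⟨⟨hp0.1, (le_abs_self _).trans hp.1.le⟩, hp.2.1.le, hp.2.2.le⟩

/-- The left-hand side of the `i`-th constraint for a single realization. -/
def rowAt (i : Fin q) (p : ℝ × Vec n × Vec m) (z : Vec d) : ℝ :=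
  (D.A z).mulVec p.2.1.ofLp i + (D.B z).mulVec p.2.2.ofLp i + D.Q p.1 z i

/-- The left-hand side of the `i`-th expected constraint. -/
def row (π : Measure (Vec d)) (i : Fin q) (p : ℝ × Vec n × Vec m) : ℝ :=
  (D.EA π).mulVec p.2.1.ofLp i + (D.EB π).mulVec p.2.2.ofLp i + D.EQ π p.1 i

/-- The sample average of the left-hand side of the `i`-th constraint. -/
def saaRow (s : ℕ → Vec d) (ν : ℕ) (i : Fin q) (p : ℝ × Vec n × Vec m) : ℝ :=
  (ν : ℝ)⁻¹ • ∑ l ∈ Finset.range ν, D.rowAt i p (s l)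

/-- The sample average of the objective, without regularization. -/
def saaG (s : ℕ → Vec d) (ν : ℕ) (p : ℝ × Vec n × Vec m) : ℝ :=
  (ν : ℝ)⁻¹ • ∑ l ∈ Finset.range ν, D.g p.1 p.2.1 p.2.2 (s l)

/-- A realization of the sample along which the law of large numbers holds for all data. -/
structure GoodSample (π : Measure (Vec d)) (ρ : Vec d → ℝ) (s : ℕ → Vec d) : Prop where
  tendsto_f : ∀ R : ℕ, TendstoUniformlyOn (fun ν p => D.saaF s ν p.1 p.2.1 p.2.2)
    (fun p => D.Ef π p.1 p.2.1 p.2.2) atTop (box n m R)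
  tendsto_g : ∀ R : ℕ, TendstoUniformlyOn (fun ν p => D.saaG s ν p)
    (fun p => D.Eg π p.1 p.2.1 p.2.2) atTop (box n m R)
  tendsto_row : ∀ R : ℕ, ∀ i, TendstoUniformlyOn (fun ν p => D.saaRow s ν i p)
    (fun p => D.row π i p) atTop (box n m R)
  tendsto_weight : Tendsto (fun ν : ℕ => (ν : ℝ)⁻¹ * ∑ l ∈ Finset.range ν, ρ (s l)) atTop
    (𝓝 (∫ z, ρ z ∂π))
  convex_g : ∀ l, ∀ t, 0 ≤ t → ∀ x : Vec n, ConvexOn ℝ univ (fun y => D.g t x y (s l))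

variable {D} {π : Measure (Vec d)}

theorem mulVec_integral {k : ℕ} (M : Vec d → Matrix (Fin q) (Fin k) ℝ)
    (hM : ∀ i j, Integrable (fun z => M z i j) π) (x : Fin k → ℝ) (i : Fin q) :
    Integrable (fun z => (M z).mulVec x i) π ∧
      (Matrix.of fun i j => ∫ z, M z i j ∂π).mulVec x i = ∫ z, (M z).mulVec x i ∂π := by
  have h : ∀ j ∈ (Finset.univ : Finset (Fin k)), Integrable (fun z => M z i j * x j) π :=
    fun j _ => (hM i j).mul_const _
  constructor
  · exact integrable_finsetSum _ h
  · simp only [Matrix.mulVec, dotProduct, Matrix.of_apply]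
    rw [integral_finsetSum _ h]
    simp [integral_mul_const]

theorem abs_mulVec_le {k : ℕ} (M : Matrix (Fin q) (Fin k) ℝ) (x : Vec k) (i : Fin q) {R : ℝ}
    (hx : ‖x‖ ≤ R) : |M.mulVec x.ofLp i| ≤ ∑ j, |M i j| * R := by
  simp only [Matrix.mulVec, dotProduct]
  refine (Finset.abs_sum_le_sum_abs _ _).trans (Finset.sum_le_sum fun j _ => ?_)
  rw [abs_mul]
  gcongr
  exact (PiLp.norm_apply_le x j).trans hx

namespace Standing

variable (hD : D.Standing π)
include hD

theorem integrable_Q_apply {t : ℝ} (ht : 0 ≤ t) (i : Fin q) :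
    Integrable (fun z => D.Q t z i) π :=
  (EuclideanSpace.proj (𝕜 := ℝ) i).integrable_comp (hD.integrable_Q t ht)

theorem integrable_rowAt (i : Fin q) {p : ℝ × Vec n × Vec m} (hp : 0 ≤ p.1) :
    Integrable (D.rowAt i p) π :=
  ((mulVec_integral D.A hD.integrable_A _ i).1.add
    (mulVec_integral D.B hD.integrable_B _ i).1).add (hD.integrable_Q_apply hp i)

/-- Rewriting the separate means of `A`, `B` and `Q` as the mean of one integrand brings the
constraints under the same law of large numbers as `f` and `g`. -/
theorem row_eq (i : Fin q) {p : ℝ × Vec n × Vec m} (hp : 0 ≤ p.1) :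
    D.row π i p = ∫ z, D.rowAt i p z ∂π := by
  have hA := mulVec_integral D.A hD.integrable_A p.2.1.ofLp i
  have hB := mulVec_integral D.B hD.integrable_B p.2.2.ofLp i
  have hQ : D.EQ π p.1 i = ∫ z, D.Q p.1 z i ∂π :=
    ((EuclideanSpace.proj (𝕜 := ℝ) i).integral_comp_comm (hD.integrable_Q _ hp)).symm
  unfold row rowAt EA EB
  rw [hA.2, hB.2, hQ, ← integral_add hA.1 hB.1]
  exact (integral_add (hA.1.add hB.1) (hD.integrable_Q_apply hp i)).symm

theorem row_bound (i : Fin q) (R : ℝ) : ∃ κ : Vec d → ℝ, Integrable κ π ∧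
    ∀ᵐ z ∂π, ∀ p ∈ box n m R, ‖D.rowAt i p z‖ ≤ κ z := by
  obtain ⟨κ, -, hκ0, hκi, hκ⟩ := hD.bound_Q
  refine ⟨fun z => (∑ j, |D.A z i j| * R) + (∑ j, |D.B z i j| * R) + κ z * R, ?_, ?_⟩
  · refine ((integrable_finsetSum _ fun j _ => ?_).add
      (integrable_finsetSum _ fun j _ => ?_)).add (hκi.mul_const _)
    · exact (hD.integrable_A i j).abs.mul_const _
    · exact (hD.integrable_B i j).abs.mul_const _
  · filter_upwards [hκ] with z hz
    rintro ⟨t, x, y⟩ hp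
    obtain ⟨⟨ht0, htR⟩, hx, hy⟩ := mem_box.1 hp
    refine (norm_add_le _ _).trans (add_le_add ((norm_add_le _ _).trans (add_le_add ?_ ?_)) ?_)
    · exact abs_mulVec_le _ _ _ hx
    · exact abs_mulVec_le _ _ _ hy
    · refine (PiLp.norm_apply_le (D.Q t z) i).trans ((hz t ht0).trans ?_)
      exact mul_le_mul_of_nonneg_left htR (hκ0 z)

theorem row_continuousOn (i : Fin q) (R : ℝ) :
    ∀ᵐ z ∂π, ContinuousOn (fun p => D.rowAt i p z) (box n m R) := by
  filter_upwards [hD.continuous_Q] with z hz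
  have h1 : Continuous fun p : ℝ × Vec n × Vec m => (D.A z).mulVec p.2.1.ofLp i := by
    simp only [Matrix.mulVec, dotProduct]; fun_prop
  have h2 : Continuous fun p : ℝ × Vec n × Vec m => (D.B z).mulVec p.2.2.ofLp i := by
    simp only [Matrix.mulVec, dotProduct]; fun_prop
  refine (h1.add h2).continuousOn.add ?_
  have h3 : ContinuousOn (fun p : ℝ × Vec n × Vec m => D.Q p.1 z) (box n m R) :=
    hz.comp continuousOn_fst fun p hp => hp.1.1
  exact (EuclideanSpace.proj (𝕜 := ℝ) i).continuous.comp_continuousOn h3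

theorem f_bound (R : ℝ) : ∃ κ : Vec d → ℝ, Integrable κ π ∧
    ∀ᵐ z ∂π, ∀ p ∈ box n m R, ‖D.f p.1 p.2.1 p.2.2 z‖ ≤ κ z := by
  obtain ⟨κ, -, hκ0, hκi, hκ⟩ := hD.lipschitz_f
  refine ⟨fun z => ‖D.f 0 0 0 z‖ + κ z * (R + R + R),
    (hD.integrable_f 0 le_rfl 0 0).norm.add (hκi.mul_const _), ?_⟩
  filter_upwards [hκ] with z hz
  rintro ⟨t, x, y⟩ hp
  obtain ⟨⟨ht0, htR⟩, hx, hy⟩ := mem_box.1 hp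
  have h := hz t 0 ht0 le_rfl x 0 y 0
  have h' : κ z * (|t - 0| + ‖x - 0‖ + ‖y - 0‖) ≤ κ z * (R + R + R) := by
    refine mul_le_mul_of_nonneg_left ?_ (hκ0 z)
    simp only [sub_zero, abs_of_nonneg ht0]
    gcongr
  calc ‖D.f t x y z‖ = ‖D.f 0 0 0 z + (D.f t x y z - D.f 0 0 0 z)‖ := by congr 1; abel
    _ ≤ _ := (norm_add_le _ _).trans (by gcongr; exact h.trans h')

theorem f_continuousOn (R : ℝ) :
    ∀ᵐ z ∂π, ContinuousOn (fun p : ℝ × Vec n × Vec m => D.f p.1 p.2.1 p.2.2 z) (box n m R) := by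
  obtain ⟨κ, -, hκ0, hκi, hκ⟩ := hD.lipschitz_f
  filter_upwards [hκ] with z hz
  rintro ⟨t, x, y⟩ hp
  have hlim : Tendsto (fun p : ℝ × Vec n × Vec m =>
      κ z * (|p.1 - t| + ‖p.2.1 - x‖ + ‖p.2.2 - y‖)) (𝓝[box n m R] (t, x, y)) (𝓝 0) := by
    have : Continuous fun p : ℝ × Vec n × Vec m =>
      κ z * (|p.1 - t| + ‖p.2.1 - x‖ + ‖p.2.2 - y‖) := by fun_prop
    have h := this.continuousWithinAt (s := box n m R) (x := (t, x, y))
    simpa [ContinuousWithinAt] using h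
  refine tendsto_iff_norm_sub_tendsto_zero.2 (squeeze_zero' ?_ ?_ hlim)
  · exact Eventually.of_forall fun _ => norm_nonneg _
  · filter_upwards [self_mem_nhdsWithin] with p hp'
    exact hz _ _ hp'.1.1 hp.1.1 _ _ _ _

theorem g_bound (R : ℝ) : ∃ κ : Vec d → ℝ, Integrable κ π ∧
    ∀ᵐ z ∂π, ∀ p ∈ box n m R, ‖D.g p.1 p.2.1 p.2.2 z‖ ≤ κ z := by
  obtain ⟨κ, hκi, hκ⟩ := hD.dominated_g R
  refine ⟨κ, hκi, ?_⟩
  filter_upwards [hκ] with z hz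
  rintro ⟨t, x, y⟩ hp
  obtain ⟨⟨ht0, htR⟩, hx, hy⟩ := mem_box.1 hp
  exact hz t ht0 htR x y hx hy

theorem g_continuousOn (R : ℝ) :
    ∀ᵐ z ∂π, ContinuousOn (fun p : ℝ × Vec n × Vec m => D.g p.1 p.2.1 p.2.2 z) (box n m R) := by
  filter_upwards [hD.continuous_g] with z hz
  exact hz.mono fun p hp => ⟨hp.1.1, mem_univ _⟩

end Standing

/-! ### Almost every sample is good. -/

section Law

variable {Ω : Type*} [MeasurableSpace Ω] {P : Measure Ω} {ξ : Ω → Vec d} {ξs : ℕ → Ω → Vec d}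

theorem law_f (hD : D.Standing (P.map ξ)) (hindep : iIndepFun ξs P)
    (hident : ∀ l, IdentDistrib (ξs l) ξ P P) (R : ℕ) :
    ContinuousOn (fun p : ℝ × Vec n × Vec m => D.Ef (P.map ξ) p.1 p.2.1 p.2.2) (box n m R) ∧
      ∀ᵐ ω ∂P, TendstoUniformlyOn (fun ν p => D.saaF (fun l => ξs l ω) ν p.1 p.2.1 p.2.2)
        (fun p => D.Ef (P.map ξ) p.1 p.2.1 p.2.2) atTop (box n m R) := by
  obtain ⟨κ, hκi, hκ⟩ := hD.f_bound R
  exact uniform_strong_law hindep hident (isCompact_box (R : ℝ))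
    (fun (p : ℝ × Vec n × Vec m) z => D.f p.1 p.2.1 p.2.2 z)
    (fun p hp => hD.integrable_f _ hp.1.1 _ _) (hD.f_continuousOn R) hκi hκ

theorem law_g (hD : D.Standing (P.map ξ)) (hindep : iIndepFun ξs P)
    (hident : ∀ l, IdentDistrib (ξs l) ξ P P) (R : ℕ) :
    ContinuousOn (fun p : ℝ × Vec n × Vec m => D.Eg (P.map ξ) p.1 p.2.1 p.2.2) (box n m R) ∧
      ∀ᵐ ω ∂P, TendstoUniformlyOn (fun ν p => D.saaG (fun l => ξs l ω) ν p)
        (fun p => D.Eg (P.map ξ) p.1 p.2.1 p.2.2) atTop (box n m R) := by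
  obtain ⟨κ, hκi, hκ⟩ := hD.g_bound R
  exact uniform_strong_law hindep hident (isCompact_box (R : ℝ))
    (fun (p : ℝ × Vec n × Vec m) z => D.g p.1 p.2.1 p.2.2 z)
    (fun p hp => hD.integrable_g _ hp.1.1 _ _) (hD.g_continuousOn R) hκi hκ

theorem law_row (hD : D.Standing (P.map ξ)) (hindep : iIndepFun ξs P)
    (hident : ∀ l, IdentDistrib (ξs l) ξ P P) (R : ℕ) (i : Fin q) :
    ContinuousOn (D.row (P.map ξ) i) (box n m R) ∧
      ∀ᵐ ω ∂P, TendstoUniformlyOn (fun ν p => D.saaRow (fun l => ξs l ω) ν i p)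
        (fun p => D.row (P.map ξ) i p) atTop (box n m R) := by
  obtain ⟨κ, hκi, hκ⟩ := hD.row_bound i R
  have h := uniform_strong_law hindep hident (isCompact_box (R : ℝ)) (D.rowAt i)
    (fun p hp => hD.integrable_rowAt i hp.1.1) (hD.row_continuousOn i R) hκi hκ
  have he : EqOn (D.row (P.map ξ) i) (fun p => ∫ z, D.rowAt i p z ∂P.map ξ) (box n m R) :=
    fun p hp => hD.row_eq i hp.1.1
  refine ⟨h.1.congr he, ?_⟩
  filter_upwards [h.2] with ω hω
  exact hω.congr_right he.symm

theorem ae_goodSample (hD : D.Standing (P.map ξ))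
    (hindep : iIndepFun ξs P) (hident : ∀ l, IdentDistrib (ξs l) ξ P P) {ρ : Vec d → ℝ}
    (hρm : Measurable ρ) (hρi : Integrable ρ (P.map ξ)) :
    ∀ᵐ ω ∂P, D.GoodSample (P.map ξ) ρ (fun l => ξs l ω) := by
  have hf := ae_all_iff.2 fun R => (law_f hD hindep hident R).2
  have hg := ae_all_iff.2 fun R => (law_g hD hindep hident R).2
  have hr := ae_all_iff.2 fun R => ae_all_iff.2 fun i => (law_row hD hindep hident R i).2
  have hc : ∀ᵐ ω ∂P, ∀ l, ∀ t, 0 ≤ t → ∀ x : Vec n,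
      ConvexOn ℝ univ (fun y => D.g t x y (ξs l ω)) := by
    refine ae_all_iff.2 fun l => ?_
    refine ae_of_ae_map (p := fun z => ∀ t, 0 ≤ t → ∀ x : Vec n,
      ConvexOn ℝ univ (fun y => D.g t x y z)) (hident l).aemeasurable_fst ?_
    rw [(hident l).map_eq]
    exact hD.convex_g
  have hmap : P.map (ξs 0) = P.map ξ := (hident 0).map_eq
  have hw := strong_law_ae (μ := P) (fun l ω => ρ (ξs l ω))
    (by
      have h0 := hρi
      rw [← hmap] at h0
      exact h0.comp_aemeasurable (hident 0).aemeasurable_fst)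
    (fun i j hij => (hindep.indepFun hij).comp hρm hρm)
    (fun l => ((hident l).trans (hident 0).symm).comp hρm)
  have hE : ∫ ω, ρ (ξs 0 ω) ∂P = ∫ z, ρ z ∂P.map ξ := by
    rw [← hmap, integral_map (hident 0).aemeasurable_fst hρm.aestronglyMeasurable]
  filter_upwards [hf, hg, hr, hc, hw] with ω h1 h2 h3 h4 h5
  exact ⟨h1, h2, h3, by simpa [hE] using h5, h4⟩

end Law

end OCDE

/-! ### A barrier sphere for the minimizers. -/

section Barrier

/-- If the sublevel set of `G` on the feasible region at `(0, x₀)` is bounded, then uniformly for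
`(t, x)` near `(0, x₀)`, every point of some sphere around `y₀` is either infeasible or has a
value of `G` well above the value at `y₀`. -/
theorem exists_barrier {X Y ι : Type*} [NormedAddCommGroup X] [NormedAddCommGroup Y]
    [ProperSpace Y] [Finite ι] {G : ℝ × X × Y → ℝ} {C : ι → ℝ × X × Y → ℝ}
    (hG : ContinuousOn G (Ici 0 ×ˢ univ)) (hC : ∀ i, ContinuousOn (C i) (Ici 0 ×ˢ univ))
    {x₀ : X} {y₀ : Y} (hslater : ∀ i, C i (0, x₀, y₀) < 0) {c : ℝ}
    (hlevel : Bornology.IsBounded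
      {y | (∀ i, C i (0, x₀, y) ≤ 0) ∧ G (0, x₀, y) ≤ G (0, x₀, y₀) + c}) :
    ∃ R > 0, ∃ ε > 0, ∀ t, 0 ≤ t → t ≤ ε → ∀ x, ‖x - x₀‖ ≤ ε →
      (∀ i, C i (t, x, y₀) < -ε) ∧
      ∀ z, ‖z - y₀‖ = R → (∃ i, ε < C i (t, x, z)) ∨ G (t, x, y₀) + c + ε < G (t, x, z) := by
  -- Clamping time at 0 turns continuity on `t ≥ 0` into continuity everywhere, so ordinary
  -- neighbourhoods can be used.
  let e : ℝ × X × Y → ℝ × X × Y := fun p => (max p.1 0, p.2)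
  have he : Continuous e := by fun_prop
  have hmem : ∀ p, e p ∈ (Ici (0 : ℝ) ×ˢ (univ : Set (X × Y))) := fun p =>
    ⟨le_max_right p.1 0, mem_univ _⟩
  have hG' : Continuous fun p => G (e p) := hG.comp_continuous he hmem
  have hC' : ∀ i, Continuous fun p => C i (e p) := fun i => (hC i).comp_continuous he hmem
  obtain ⟨r, hr⟩ := hlevel.subset_closedBall y₀
  let R := max r 0 + 1
  have hR : 0 < R := by positivity
  -- The margin is itself the first coordinate of the parameter, so one neighbourhood of `(0, 0,
  -- x₀)` yields both the margin and the range of `(t, x)`. Compactness of the sphere gives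
  -- uniformity in `z`.
  have h1 : ∀ᶠ p : ℝ × ℝ × X in 𝓝 (0, 0, x₀), ∀ z ∈ Metric.sphere y₀ R,
      (∃ i, p.1 < C i (e (p.2.1, p.2.2, z))) ∨
        G (e (p.2.1, p.2.2, y₀)) + c + p.1 < G (e (p.2.1, p.2.2, z)) := by
    refine (isCompact_sphere y₀ R).eventually_forall_of_forall_eventually (P := fun (p : ℝ × ℝ × X) z =>
      (∃ i, p.1 < C i (e (p.2.1, p.2.2, z))) ∨
        G (e (p.2.1, p.2.2, y₀)) + c + p.1 < G (e (p.2.1, p.2.2, z))) fun z hz => ?_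
    have hz' : (∃ i, 0 < C i (0, x₀, z)) ∨ G (0, x₀, y₀) + c < G (0, x₀, z) := by
      by_contra! hcon
      have := hr (show z ∈ _ from hcon)
      rw [Metric.mem_closedBall, Metric.mem_sphere.1 hz] at this
      have := le_max_left r 0
      simp only [R] at *
      linarith
    rcases hz' with ⟨i, hi⟩ | hlt
    · have hc1 : Continuous fun w : (ℝ × ℝ × X) × Y => w.1.1 := by fun_prop
      have hc2 : Continuous fun w : (ℝ × ℝ × X) × Y => C i (e (w.1.2.1, w.1.2.2, w.2)) :=
        (hC' i).comp (by fun_prop)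
      have := hc1.continuousAt.eventually_lt (x₀ := ((0, 0, x₀), z)) hc2.continuousAt
        (by simpa [e] using hi)
      filter_upwards [this] with w hw using Or.inl ⟨i, hw⟩
    · have hc1 : Continuous fun w : (ℝ × ℝ × X) × Y =>
          G (e (w.1.2.1, w.1.2.2, y₀)) + c + w.1.1 :=
        ((hG'.comp (g := fun p => G (e p)) (f := fun w : (ℝ × ℝ × X) × Y =>
          (w.1.2.1, w.1.2.2, y₀)) (by fun_prop)).add continuous_const).add (by fun_prop)
      have hc2 : Continuous fun w : (ℝ × ℝ × X) × Y => G (e (w.1.2.1, w.1.2.2, w.2)) :=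
        hG'.comp (g := fun p => G (e p)) (by fun_prop)
      have := hc1.continuousAt.eventually_lt (x₀ := ((0, 0, x₀), z)) hc2.continuousAt
        (by simpa [e] using hlt)
      filter_upwards [this] with w hw using Or.inr hw
  have h2 : ∀ᶠ p : ℝ × ℝ × X in 𝓝 (0, 0, x₀), ∀ i, C i (e (p.2.1, p.2.2, y₀)) < -p.1 := by
    refine eventually_all.2 fun i => ?_
    have hc1 : Continuous fun w : ℝ × ℝ × X => -w.1 := by fun_prop
    have hc2 : Continuous fun w : ℝ × ℝ × X => C i (e (w.2.1, w.2.2, y₀)) :=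
      (hC' i).comp (by fun_prop)
    exact hc2.continuousAt.eventually_lt (x₀ := (0, 0, x₀)) hc1.continuousAt
      (by simpa [e] using hslater i)
  obtain ⟨r', hr', hball⟩ := Metric.eventually_nhds_iff_ball.1 (h1.and h2)
  refine ⟨R, hR, r' / 2, by positivity, fun t ht htr x hx => ?_⟩
  have hp : ((r' / 2, t, x) : ℝ × ℝ × X) ∈ Metric.ball (0, 0, x₀) r' := by
    simp only [Metric.mem_ball, Prod.dist_eq, max_lt_iff, Real.dist_eq, sub_zero]
    rw [dist_eq_norm, abs_of_nonneg ht, abs_of_pos (by positivity)]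
    refine ⟨?_, ?_, ?_⟩ <;> linarith
  have het : ∀ z : Y, e (t, x, z) = (t, x, z) := fun z => by simp [e, ht]
  obtain ⟨h3, h4⟩ := hball _ hp
  refine ⟨fun i => ?_, fun z hz => ?_⟩
  · simpa [het] using h4 i
  · simpa [het] using h3 z (by simpa [dist_eq_norm] using hz)

/-- A feasible point that is no worse than `y₀` lies in a ball around `y₀` as soon as the points
of the bounding sphere are infeasible or worse than `y₀`. -/
theorem norm_sub_le_of_barrier {Y ι : Type*} [NormedAddCommGroup Y] [NormedSpace ℝ Y]
    {φ : Y → ℝ} {C : ι → Y → ℝ} (hφ : ConvexOn ℝ univ φ) (hC : ∀ i, ConvexOn ℝ univ (C i))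
    {y₀ y : Y} {R : ℝ} (hR : 0 < R) (hy₀ : ∀ i, C i y₀ ≤ 0) (hy : ∀ i, C i y ≤ 0)
    (hle : φ y ≤ φ y₀) (hbar : ∀ z, ‖z - y₀‖ = R → (∃ i, 0 < C i z) ∨ φ y₀ < φ z) :
    ‖y - y₀‖ ≤ R := by
  by_contra! hlt
  have hpos : 0 < ‖y - y₀‖ := hR.trans hlt
  have hθ : R / ‖y - y₀‖ ∈ Icc (0 : ℝ) 1 := ⟨by positivity, (div_le_one hpos).2 hlt.le⟩
  -- The point where the segment from `y₀` to `y` crosses the sphere; there each convex function is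
  -- at most the maximum of its endpoint values.
  let z := y₀ + (R / ‖y - y₀‖) • (y - y₀)
  have hz : z ∈ segment ℝ y₀ y := by
    rw [segment_eq_image']
    exact ⟨_, hθ, rfl⟩
  have hzR : ‖z - y₀‖ = R := by
    simp only [z, add_sub_cancel_left, norm_smul, Real.norm_eq_abs, abs_of_nonneg hθ.1]
    field_simp
  rcases hbar z hzR with ⟨i, hi⟩ | h
  · exact absurd ((hC i).le_max_of_mem_segment (mem_univ _) (mem_univ _) hz)
      (not_le.2 ((max_le (hy₀ i) (hy i)).trans_lt hi))
  · exact absurd (hφ.le_max_of_mem_segment (mem_univ _) (mem_univ _) hz)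
      (not_le.2 ((max_le le_rfl hle).trans_lt h))

end Barrier

/-! ### Convexity of the sampled problems and the Slater point. -/

namespace OCDE

variable {n m q d : ℕ} {D : OCDE n m q d} {π : Measure (Vec d)}

theorem mem_K {t : ℝ} {x : Vec n} {y : Vec m} :
    y ∈ D.K π t x ↔ ∀ i, D.row π i (t, x, y) ≤ 0 := Iff.rfl

theorem mem_saaK {s : ℕ → Vec d} {ν : ℕ} {t : ℝ} {x : Vec n} {y : Vec m} :
    y ∈ D.saaK s ν t x ↔ ∀ i, D.saaRow s ν i (t, x, y) ≤ 0 := Iff.rfl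

theorem saaObj_eq (s : ℕ → Vec d) (ν : ℕ) (ρ : Vec d → ℝ) (μ t : ℝ) (x : Vec n) (y : Vec m) :
    D.saaObj s ν ρ μ t x y = D.saaG s ν (t, x, y)
      + μ / 2 * ((ν : ℝ)⁻¹ * ∑ l ∈ Finset.range ν, ρ (s l)) * ‖y‖ ^ 2 := by
  simp only [saaObj, saaG, smul_eq_mul, ← Finset.sum_mul]
  rw [div_mul_eq_div_div, div_eq_mul_inv (μ / 2)]
  ring

theorem convexOn_const_add_mulVec_add {k : ℕ} (M : Matrix (Fin q) (Fin k) ℝ) (i : Fin q)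
    (a b : ℝ) : ConvexOn ℝ univ fun y : Vec k => a + M.mulVec y.ofLp i + b := by
  refine ⟨convex_univ, fun y _ y' _ r r' _ _ hr => le_of_eq ?_⟩
  simp only [WithLp.ofLp_add, WithLp.ofLp_smul, Matrix.mulVec_add, Matrix.mulVec_smul,
    Pi.add_apply, Pi.smul_apply, smul_eq_mul]
  linear_combination (-a - b) * hr

theorem convexOn_row (i : Fin q) (t : ℝ) (x : Vec n) :
    ConvexOn ℝ univ fun y : Vec m => D.row π i (t, x, y) :=
  convexOn_const_add_mulVec_add (D.EB π) i ((D.EA π).mulVec x.ofLp i) (D.EQ π t i)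

theorem convexOn_average {k : ℕ} (h : ℕ → Vec k → ℝ) (hh : ∀ l, ConvexOn ℝ univ (h l)) (ν : ℕ) :
    ConvexOn ℝ univ fun y => (ν : ℝ)⁻¹ • ∑ l ∈ Finset.range ν, h l y := by
  refine ConvexOn.smul (by positivity) ?_
  induction ν with
  | zero => simpa using convexOn_const (0 : ℝ) convex_univ
  | succ N ih => simp only [Finset.sum_range_succ]; exact ih.add (hh N)

theorem convexOn_saaRow (s : ℕ → Vec d) (ν : ℕ) (i : Fin q) (t : ℝ) (x : Vec n) :
    ConvexOn ℝ univ fun y : Vec m => D.saaRow s ν i (t, x, y) :=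
  convexOn_average _ (fun l => convexOn_const_add_mulVec_add (D.B (s l)) i
    ((D.A (s l)).mulVec x.ofLp i) (D.Q t (s l) i)) ν

theorem convexOn_saaObj {s : ℕ → Vec d} {ν : ℕ} {ρ : Vec d → ℝ} {μ t : ℝ} {x : Vec n}
    (hρ : ∀ z, 0 < ρ z) (hμ : 0 < μ) (hg : ∀ l, ConvexOn ℝ univ (fun y => D.g t x y (s l))) :
    ConvexOn ℝ univ fun y : Vec m => D.saaObj s ν ρ μ t x y := by
  simp only [saaObj_eq]
  refine (convexOn_average _ hg ν).add (ConvexOn.smul ?_ ?_)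
  · have : 0 ≤ ∑ l ∈ Finset.range ν, ρ (s l) := Finset.sum_nonneg fun l _ => (hρ _).le
    positivity
  · exact convexOn_univ_norm.pow (fun _ _ => norm_nonneg _) 2

/-- There is a strictly feasible point at `(0, x₀)`. -/
theorem exists_slater (hint : (interior (D.K π 0 D.x₀)).Nonempty)
    (hrow : D.NoActiveTrivialRow π) : ∃ y₀ : Vec m, ∀ i, D.row π i (0, D.x₀, y₀) < 0 := by
  obtain ⟨y₀, hy₀⟩ := hint
  refine ⟨y₀, fun i => ?_⟩
  by_cases hB : ∀ j, D.EB π i j = 0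
  · have h0 : (D.EB π).mulVec y₀.ofLp i = 0 := by simp [Matrix.mulVec, dotProduct, hB]
    simpa [row, h0] using hrow i hB
  · push Not at hB
    obtain ⟨j, hj⟩ := hB
    -- A small move along `v` stays in `K` but raises row `i` by a positive multiple of a square, so
    -- row `i` was strictly negative at `y₀`.
    let v : Vec m := EuclideanSpace.single j (D.EB π i j)
    have hv : (D.EB π).mulVec v.ofLp i = D.EB π i j * D.EB π i j := by
      simp [v]
    have hc : Tendsto (fun δ : ℝ => y₀ + δ • v) (𝓝[>] 0) (𝓝 y₀) := by
      have : Continuous fun δ : ℝ => y₀ + δ • v := by fun_prop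
      have h := (this.tendsto 0).mono_left (nhdsWithin_le_nhds (s := Ioi 0))
      simpa using h
    obtain ⟨δ, hδK, hδ⟩ :=
      ((hc.eventually (mem_interior_iff_mem_nhds.1 hy₀)).and self_mem_nhdsWithin).exists
    have h := mem_K.1 hδK i
    have he : D.row π i (0, D.x₀, y₀ + δ • v) =
        D.row π i (0, D.x₀, y₀) + δ * (D.EB π i j * D.EB π i j) := by
      simp only [row, WithLp.ofLp_add, WithLp.ofLp_smul, Matrix.mulVec_add, Matrix.mulVec_smul,
        Pi.add_apply, Pi.smul_apply, smul_eq_mul, hv]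
      ring
    have : 0 < δ * (D.EB π i j * D.EB π i j) := mul_pos hδ (mul_self_pos.2 hj)
    linarith

theorem IsSAASolution.hasDerivWithinAt_Ici {s : ℕ → Vec d} {ν : ℕ} {ρ : Vec d → ℝ} {μ T₀ : ℝ}
    {x : ℝ → Vec n} {y : ℝ → Vec m} (h : D.IsSAASolution s ν ρ μ T₀ x y) {t : ℝ}
    (ht : t ∈ Ico 0 T₀) : HasDerivWithinAt x (D.saaF s ν t (x t) (y t)) (Ici t) t :=
  (h.deriv_eq t ⟨ht.1, ht.2.le⟩).mono_of_mem_nhdsWithin (Icc_mem_nhdsGE_of_mem ht)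

end OCDE

/-! ### A priori bounds on a common interval. -/

namespace OCDE

variable {n m q d : ℕ} {D : OCDE n m q d} {π : Measure (Vec d)}

/-- Continuity of the expected data on `t ≥ 0`. -/
structure ExpectedContinuous (D : OCDE n m q d) (π : Measure (Vec d)) : Prop where
  f : ContinuousOn (fun p : ℝ × Vec n × Vec m => D.Ef π p.1 p.2.1 p.2.2) (Ici 0 ×ˢ univ)
  g : ContinuousOn (fun p : ℝ × Vec n × Vec m => D.Eg π p.1 p.2.1 p.2.2) (Ici 0 ×ˢ univ)
  row : ∀ i, ContinuousOn (D.row π i) (Ici 0 ×ˢ univ)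

theorem expectedContinuous {Ω : Type*} [MeasurableSpace Ω] {P : Measure Ω} {ξ : Ω → Vec d}
    {ξs : ℕ → Ω → Vec d} (hD : D.Standing (P.map ξ)) (hindep : iIndepFun ξs P)
    (hident : ∀ l, IdentDistrib (ξs l) ξ P P) : D.ExpectedContinuous (P.map ξ) where
  f := continuousOn_of_box fun R => (law_f hD hindep hident R).1
  g := continuousOn_of_box fun R => (law_g hD hindep hident R).1
  row i := continuousOn_of_box fun R => (law_row hD hindep hident R i).1

theorem box_subset (R : ℝ) : box n m R ⊆ Ici 0 ×ˢ univ := fun _ hp => ⟨hp.1.1, mem_univ _⟩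

/-- What holds eventually for the sample averages, uniformly on a box. -/
structure IsClose (D : OCDE n m q d) (π : Measure (Vec d)) (ρ : Vec d → ℝ) (s : ℕ → Vec d)
    (ν : ℕ) (R ε : ℝ) : Prop where
  f : ∀ p ∈ box n m R, ‖D.saaF s ν p.1 p.2.1 p.2.2 - D.Ef π p.1 p.2.1 p.2.2‖ < ε
  g : ∀ p ∈ box n m R, |D.saaG s ν p - D.Eg π p.1 p.2.1 p.2.2| < ε
  row : ∀ i, ∀ p ∈ box n m R, |D.saaRow s ν i p - D.row π i p| < ε
  weight : |(ν : ℝ)⁻¹ * ∑ l ∈ Finset.range ν, ρ (s l) - ∫ z, ρ z ∂π| < ε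

theorem GoodSample.eventually_isClose {ρ : Vec d → ℝ} {s : ℕ → Vec d} (hs : D.GoodSample π ρ s)
    (R : ℕ) {ε : ℝ} (hε : 0 < ε) : ∀ᶠ ν : ℕ in atTop, D.IsClose π ρ s ν R ε := by
  have hf := Metric.tendstoUniformlyOn_iff.1 (hs.tendsto_f R) ε hε
  have hg := Metric.tendstoUniformlyOn_iff.1 (hs.tendsto_g R) ε hε
  have hr := eventually_all.2 fun i => Metric.tendstoUniformlyOn_iff.1 (hs.tendsto_row R i) ε hε
  have hw := Metric.tendsto_nhds.1 hs.tendsto_weight ε hε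
  filter_upwards [hf, hg, hr, hw] with ν h1 h2 h3 h4
  refine ⟨fun p hp => ?_, fun p hp => ?_, fun i p hp => ?_, ?_⟩
  · simpa [dist_eq_norm, norm_sub_rev] using h1 p hp
  · simpa [dist_eq_norm, norm_sub_rev, abs_sub_comm] using h2 p hp
  · simpa [dist_eq_norm, norm_sub_rev, abs_sub_comm] using h3 i p hp
  · simpa [dist_eq_norm] using h4

/-- A priori bounds for a pair `(x, y)` on `[0, T]`. -/
structure IsBoundedPair (T ε R : ℝ) (M : NNReal) (x₀ : Vec n) (x : ℝ → Vec n) (y : ℝ → Vec m) :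
    Prop where
  near : ∀ t ∈ Icc 0 T, ‖x t - x₀‖ ≤ ε
  norm_x : ∀ t ∈ Icc 0 T, ‖x t‖ ≤ R
  norm_y : ∀ t ∈ Icc 0 T, ‖y t‖ ≤ R
  lipschitz : LipschitzOnWith M x (Icc 0 T)

/-- `T`, `y₀`, `ε`, `R` and `M` are fixed before the sample; only the threshold on `ν` depends on
it, and that threshold serves all `μ ≤ 1` at once. -/
theorem exists_bounds (hcont : D.ExpectedContinuous π) (hA : D.InteriorAssumption π)
    (hrow : D.NoActiveTrivialRow π) {ρ : Vec d → ℝ} (hρ : ∀ z, 0 < ρ z) {T₀ : ℝ} (hT₀ : 0 < T₀) :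
    ∃ T > 0, T ≤ T₀ ∧ ∃ (y₀ : Vec m) (ε : ℝ) (R : ℕ) (M : NNReal), T ≤ R ∧
      (∀ t ∈ Icc 0 T, ∀ x, ‖x - D.x₀‖ ≤ ε → ∀ i, D.row π i (t, x, y₀) < 0) ∧
      ∀ s : ℕ → Vec d, D.GoodSample π ρ s → ∀ᶠ ν : ℕ in atTop, ∀ μ : ℝ, 0 < μ → μ ≤ 1 →
        ∀ x y, D.IsSAASolution s ν ρ μ T₀ x y → IsBoundedPair T ε R M D.x₀ x y := by
  obtain ⟨y₀, hy₀⟩ := exists_slater hA.interior_nonempty hrow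
  set w : ℝ := ∫ z, ρ z ∂π
  have hw : 0 ≤ w := integral_nonneg fun z => (hρ z).le
  -- Bounds the regularization term at `y₀` once `μ ≤ 1` and the average weight is below `w + 1`.
  let c : ℝ := (w + 1) / 2 * ‖y₀‖ ^ 2
  obtain ⟨r, hr, ε, hε, hbar⟩ := exists_barrier hcont.g hcont.row hy₀ (c := c)
    (hA.levelBounded (D.Eg π 0 D.x₀ y₀ + c))
  obtain ⟨R, hR⟩ := exists_nat_gt (max (max (‖D.x₀‖ + ε) (r + ‖y₀‖)) T₀)
  have hR1 : ‖D.x₀‖ + ε < R := lt_of_le_of_lt (by simp) hR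
  have hR2 : r + ‖y₀‖ < R := lt_of_le_of_lt (by simp) hR
  have hR3 : T₀ < R := lt_of_le_of_lt (by simp) hR
  obtain ⟨B, hB⟩ := (isCompact_box (n := n) (m := m) (R : ℝ)).exists_bound_of_continuousOn
    (hcont.f.mono (box_subset _))
  -- The sampled velocity is below `B + 1`; the slack makes the speed bound strict.
  let M : ℝ := max B 0 + 2
  have hM : 0 < M := by positivity
  -- `T ≤ ε` keeps time within reach of the barrier, and `T ≤ ε / M` prevents a trajectory of speed
  -- `M` from leaving the `ε`-ball.
  refine ⟨min T₀ (min ε (ε / M)), by positivity, min_le_left _ _, y₀, ε, R, ⟨M, hM.le⟩, ?_, ?_, ?_⟩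
  · exact (min_le_left _ _).trans hR3.le
  · intro t ht x hx i
    have := (hbar t ht.1 (ht.2.trans ((min_le_right _ _).trans (min_le_left _ _))) x hx).1 i
    linarith
  intro s hs
  -- Accuracy `ε / 2` preserves the barrier, since comparing two objective values costs two errors
  -- against a gap of `ε`; accuracy 1 suffices for the weight and the speed.
  filter_upwards [hs.eventually_isClose R (half_pos hε), hs.eventually_isClose R one_pos]
    with ν hν hν1 μ hμ hμ1 x y hsol
  set T := min T₀ (min ε (ε / M))
  have hTT : T ≤ T₀ := min_le_left _ _
  have hTε : T ≤ ε := (min_le_right _ _).trans (min_le_left _ _)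
  have hTM : M * T ≤ ε := by
    have : T ≤ ε / M := (min_le_right _ _).trans (min_le_right _ _)
    rwa [le_div_iff₀' hM] at this
  have hxR : ∀ u : Vec n, ‖u - D.x₀‖ ≤ ε → ‖u‖ ≤ R := fun u hu => by
    have := norm_le_norm_add_norm_sub D.x₀ u
    rw [norm_sub_rev] at this
    linarith [norm_sub_rev u D.x₀]
  have hyR : ∀ v : Vec m, ‖v - y₀‖ ≤ r → ‖v‖ ≤ R := fun v hv => by
    have : ‖v‖ ≤ ‖v - y₀‖ + ‖y₀‖ := by simpa using norm_add_le (v - y₀) y₀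
    linarith
  have hy₀R : ‖y₀‖ ≤ R := by linarith
  -- the minimizers stay bounded as long as the trajectory stays near `x₀`
  have key : ∀ t ∈ Icc 0 T, ‖x t - D.x₀‖ ≤ ε → ‖y t - y₀‖ ≤ r := by
    intro t ht hxt
    have ht0 : t ∈ Icc 0 T₀ := ⟨ht.1, ht.2.trans hTT⟩
    have hbox : ∀ v : Vec m, ‖v‖ ≤ R → (t, x t, v) ∈ box n m R := fun v hv =>
      mem_box.2 ⟨⟨ht.1, ht0.2.trans hR3.le⟩, hxR _ hxt, hv⟩
    obtain ⟨hb1, hb2⟩ := hbar t ht.1 (ht.2.trans hTε) (x t) hxt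
    have hfeas : ∀ i, D.saaRow s ν i (t, x t, y₀) ≤ 0 := fun i => by
      have h1 := hb1 i
      have h2 := abs_lt.1 (hν.row i _ (hbox y₀ hy₀R))
      linarith
    refine norm_sub_le_of_barrier (convexOn_saaObj hρ hμ fun l => hs.convex_g l t ht.1 (x t))
      (fun i => convexOn_saaRow s ν i t (x t)) hr hfeas (mem_saaK.1 (hsol.feasible t ht0))
      (hsol.optimal t ht0 y₀ (mem_saaK.2 hfeas)) fun z hz => ?_
    have hzb := hbox z (hyR z hz.le)
    rcases hb2 z hz with ⟨i, hi⟩ | hlt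
    · refine Or.inl ⟨i, ?_⟩
      have h2 := abs_lt.1 (hν.row i _ hzb)
      linarith
    · right
      rw [saaObj_eq, saaObj_eq]
      have h2 := abs_lt.1 (hν.g _ hzb)
      have h3 := abs_lt.1 (hν.g _ (hbox y₀ hy₀R))
      have h4 := abs_lt.1 hν1.weight
      simp only at h2 h3 hlt
      set W := (ν : ℝ)⁻¹ * ∑ l ∈ Finset.range ν, ρ (s l)
      have hW : 0 ≤ W := by
        have : 0 ≤ ∑ l ∈ Finset.range ν, ρ (s l) := Finset.sum_nonneg fun l _ => (hρ _).le
        positivity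
      have h5 : μ / 2 * W * ‖y₀‖ ^ 2 ≤ c := by
        refine mul_le_mul_of_nonneg_right ?_ (sq_nonneg _)
        nlinarith
      have h6 : 0 ≤ μ / 2 * W * ‖z‖ ^ 2 := by positivity
      linarith
  have hspeed : ∀ t ∈ Icc 0 T, ‖x t - D.x₀‖ ≤ ε → ‖D.saaF s ν t (x t) (y t)‖ < M := by
    intro t ht hxt
    have hb : (t, x t, y t) ∈ box n m R := mem_box.2
      ⟨⟨ht.1, (ht.2.trans hTT).trans hR3.le⟩, hxR _ hxt, hyR _ (key t ht hxt)⟩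
    have h1 := hν1.f _ hb
    have h2 := hB _ hb
    simp only at h1 h2
    have h3 := norm_le_norm_add_norm_sub (D.Ef π t (x t) (y t)) (D.saaF s ν t (x t) (y t))
    have h4 := le_max_left B 0
    rw [norm_sub_rev] at h3
    simp only [M]
    linarith [norm_sub_rev (D.saaF s ν t (x t) (y t)) (D.Ef π t (x t) (y t))]
  have hxcont : ContinuousOn x (Icc 0 T) :=
    hsol.contDiffOn.continuousOn.mono (Icc_subset_Icc_right hTT)
  -- This breaks the circle between nearness and speed: the comparison principle asks for the speed
  -- bound only when `‖x t - x₀‖ = M * t`, and there `M * t ≤ ε`.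
  have hnear' : ∀ ⦃t⦄, t ∈ Icc 0 T → ‖x t - D.x₀‖ ≤ M * t := by
    refine image_norm_le_of_norm_deriv_right_lt_deriv_boundary
      (f := fun t => x t - D.x₀) (f' := fun t => D.saaF s ν t (x t) (y t)) (B' := fun _ => M)
      (hxcont.sub continuousOn_const) (fun t ht => ?_) (by simp [hsol.initial])
      (fun t => by simpa using (hasDerivAt_id t).const_mul M) fun t ht hxt => ?_
    · exact (hsol.hasDerivWithinAt_Ici ⟨ht.1, ht.2.trans_le hTT⟩).sub_const _
    · refine hspeed t ⟨ht.1, ht.2.le⟩ (hxt.le.trans (le_trans ?_ hTM))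
      exact mul_le_mul_of_nonneg_left ht.2.le hM.le
  have hnear : ∀ t ∈ Icc 0 T, ‖x t - D.x₀‖ ≤ ε := fun t ht =>
    (hnear' ht).trans ((mul_le_mul_of_nonneg_left ht.2 hM.le).trans hTM)
  refine ⟨hnear, fun t ht => hxR _ (hnear t ht), fun t ht => hyR _ (key t ht (hnear t ht)), ?_⟩
  refine (convex_Icc 0 T).lipschitzOnWith_of_nnnorm_hasDerivWithin_le
    (fun t ht => (hsol.deriv_eq t ⟨ht.1, ht.2.trans hTT⟩).mono (Icc_subset_Icc_right hTT))
    fun t ht => ?_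
  exact (hspeed t ht (hnear t ht)).le

end OCDE

/-! ### Compactness and iterated extraction. -/

section Compactness

/-- The functions on `[0, T]` that are `M`-Lipschitz and bounded by `R`. -/
def lipschitzBall (n : ℕ) (T R : ℝ) (M : NNReal) :
    Set (BoundedContinuousFunction (Icc (0 : ℝ) T) (Vec n)) :=
  {u | LipschitzWith M u ∧ ∀ t, ‖u t‖ ≤ R}

theorem isCompact_lipschitzBall (n : ℕ) (T R : ℝ) (M : NNReal) :
    IsCompact (lipschitzBall n T R M) := by
  refine BoundedContinuousFunction.arzela_ascoli₂ (Metric.closedBall 0 R)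
    (isCompact_closedBall _ _) _ ?_ (fun u t hu => by simpa using hu.2 t) ?_
  · have he : lipschitzBall n T R M = (⋂ s, ⋂ t, {u | dist (u s) (u t) ≤ M * dist s t}) ∩
        ⋂ t, {u | ‖u t‖ ≤ R} := by
      ext u
      simp only [lipschitzBall, lipschitzWith_iff_dist_le_mul, mem_inter_iff, mem_iInter,
        mem_ofPred_eq]
    rw [he]
    refine (isClosed_iInter fun s => isClosed_iInter fun t => ?_).inter (isClosed_iInter fun t => ?_)
    · exact isClosed_le (by fun_prop) continuous_const
    · exact isClosed_le (by fun_prop) continuous_const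
  · exact (LipschitzWith.uniformEquicontinuous
      (fun u : lipschitzBall n T R M => (u.1 : Icc (0 : ℝ) T → Vec n)) M fun u => u.2.1).equicontinuous

/-- The space `L²([0, T]; ℝᵐ)`. -/
abbrev L2Space (m : ℕ) (T : ℝ) : Type := Lp (Vec m) 2 (volume.restrict (Icc (0 : ℝ) T))

/-- A closed ball of the dual of `L²([0, T]; ℝᵐ)` with the weak-* topology. -/
def weakBall (m : ℕ) (T r : ℝ) : Set (WeakDual ℝ (L2Space m T)) :=
  WeakDual.toStrongDual ⁻¹' Metric.closedBall 0 r

theorem isCompact_weakBall (m : ℕ) (T r : ℝ) : IsCompact (weakBall m T r) :=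
  WeakDual.isCompact_closedBall 0 r

theorem intervalIntegral_inner_eq {m : ℕ} {T : ℝ} (hT : 0 ≤ T) {v h : ℝ → Vec m}
    (hv : MemLp v 2 (volume.restrict (Icc 0 T))) (hh : MemLp h 2 (volume.restrict (Icc 0 T))) :
    inner ℝ (hv.toLp v) (hh.toLp h) = ∫ t in (0 : ℝ)..T, inner ℝ (v t) (h t) := by
  rw [intervalIntegral.integral_of_le hT, ← integral_Icc_eq_integral_Ioc, L2.inner_def]
  refine integral_congr_ae ?_
  filter_upwards [hv.coeFn_toLp, hh.coeFn_toLp] with t h1 h2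
  rw [h1, h2]

/-- Diagonal extraction: uniform convergence of the first components and weak convergence of the
second components, in the iterated limit. -/
theorem exists_iterated_subseq {n m : ℕ} {T R : ℝ} (hT : 0 ≤ T) (hR : 0 ≤ R) {M : NNReal}
    (X : ℕ → ℕ → ℝ → Vec n) (Y : ℕ → ℕ → ℝ → Vec m)
    (hX : ∀ k, ∀ᶠ j in atTop, (∀ t ∈ Icc 0 T, ‖X k j t‖ ≤ R) ∧ LipschitzOnWith M (X k j) (Icc 0 T))
    (hY : ∀ k, ∀ᶠ j in atTop, (∀ t ∈ Icc 0 T, ‖Y k j t‖ ≤ R) ∧ ContinuousOn (Y k j) (Icc 0 T)) :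
    ∃ φ ψ : ℕ → ℕ, StrictMono φ ∧ StrictMono ψ ∧ ∃ (xs : ℝ → Vec n) (w : ℝ → Vec m),
      LipschitzOnWith M xs (Icc 0 T) ∧ MemLp w 2 (volume.restrict (Icc 0 T)) ∧
      IteratedLimit (fun k j => supNorm T (fun t => X (φ k) (ψ j) t - xs t)) 0 ∧
      IteratedWeakLimit T (fun k j => Y (φ k) (ψ j)) w := by
  let r : ℝ := (measureUnivNNReal (volume.restrict (Icc (0 : ℝ) T)) : ℝ) ^
    ((2 : ENNReal).toReal)⁻¹ * R
  have hr : 0 ≤ r := by positivity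
  let A := lipschitzBall n T R M
  let B := weakBall m T r
  have : CompactSpace A := isCompact_iff_compactSpace.1 (isCompact_lipschitzBall n T R M)
  have : CompactSpace B := isCompact_iff_compactSpace.1 (isCompact_weakBall m T r)
  have : Fact ((2 : ENNReal) ≠ ⊤) := ⟨by simp⟩
  -- Separability of `L²` makes the weak-* compact ball metrizable, so compactness yields
  -- subsequences.
  have : TopologicalSpace.MetrizableSpace B :=
    WeakDual.metrizable_of_isCompact ℝ _ _ (isCompact_weakBall m T r)
  -- Pairs violating the bounds are sent to 0; for each `k` only finitely many `j` are affected.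
  have hexA : ∀ k j, ∃ u : A, ((∀ t ∈ Icc 0 T, ‖X k j t‖ ≤ R) ∧
      LipschitzOnWith M (X k j) (Icc 0 T)) → ∀ t, u.1 t = X k j t := by
    intro k j
    by_cases h : (∀ t ∈ Icc 0 T, ‖X k j t‖ ≤ R) ∧ LipschitzOnWith M (X k j) (Icc 0 T)
    · have hL : LipschitzWith M fun t : Icc (0 : ℝ) T => X k j t := h.2.to_restrict
      exact ⟨⟨BoundedContinuousFunction.mkOfCompact ⟨_, hL.continuous⟩, hL, fun t => h.1 t t.2⟩,
        fun _ t => rfl⟩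
    · exact ⟨⟨0, LipschitzWith.const' (0 : Vec n), fun t => by simpa using hR⟩, fun h' => absurd h' h⟩
  have hexB : ∀ k j, ∃ b : B, ((∀ t ∈ Icc 0 T, ‖Y k j t‖ ≤ R) ∧
      ContinuousOn (Y k j) (Icc 0 T)) → ∀ (h : ℝ → Vec m)
        (hh : MemLp h 2 (volume.restrict (Icc 0 T))),
        b.1 (hh.toLp h) = ∫ t in (0 : ℝ)..T, inner ℝ (Y k j t) (h t) := by
    intro k j
    by_cases h : (∀ t ∈ Icc 0 T, ‖Y k j t‖ ≤ R) ∧ ContinuousOn (Y k j) (Icc 0 T)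
    · have hb : ∀ᵐ t ∂volume.restrict (Icc 0 T), ‖Y k j t‖ ≤ R :=
        (ae_restrict_iff' measurableSet_Icc).2 (Eventually.of_forall h.1)
      have hv : MemLp (Y k j) 2 (volume.restrict (Icc 0 T)) :=
        MemLp.of_bound (h.2.aestronglyMeasurable measurableSet_Icc) R hb
      refine ⟨⟨StrongDual.toWeakDual (innerSL ℝ (hv.toLp (Y k j))), ?_⟩, fun _ g hg => ?_⟩
      · simp only [B, weakBall, mem_preimage, mem_closedBall_zero_iff]
        change ‖innerSL ℝ (hv.toLp (Y k j))‖ ≤ r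
        rw [innerSL_apply_norm]
        refine Lp.norm_le_of_ae_bound hR ?_
        filter_upwards [hv.coeFn_toLp, hb] with t h1 h2
        rwa [h1]
      · exact intervalIntegral_inner_eq hT hv hg
    · refine ⟨⟨0, ?_⟩, fun h' => absurd h' h⟩
      simpa [B, weakBall] using hr
  choose u hu using hexA
  choose b hb using hexB
  -- Extracting in the countable product over `k` gives one `ψ` valid for all `k`, without a
  -- diagonal argument; `φ` is then extracted from the inner limits.
  obtain ⟨L, ψ, hψ, hL⟩ := CompactSpace.tendsto_subseq
    (fun j k => (u k j, b k j) : ℕ → ℕ → A × B)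
  have hL' : ∀ k, Tendsto (fun j => (u k (ψ j), b k (ψ j))) atTop (𝓝 (L k)) := fun k =>
    (tendsto_pi_nhds.1 hL) k
  obtain ⟨l, φ, hφ, hl⟩ := CompactSpace.tendsto_subseq L
  let xs : ℝ → Vec n := fun t => l.1.1 (projIcc 0 T hT t)
  have hxs : ∀ t : Icc (0 : ℝ) T, xs t = l.1.1 t := fun t => by simp [xs]
  let w : L2Space m T := (InnerProductSpace.toDual ℝ (L2Space m T)).symm
    (WeakDual.toStrongDual l.2.1)
  refine ⟨φ, ψ, hφ, hψ, xs, w, ?_, Lp.memLp w, ?_, ?_⟩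
  · rw [lipschitzOnWith_iff_restrict]
    convert l.1.2.1 using 1
    ext1 t
    exact hxs t
  · have hsup : ∀ (v : A), supNorm T (fun t => l.1.1 (projIcc 0 T hT t) -
        v.1 (projIcc 0 T hT t)) = dist v.1 l.1.1 := by
      intro v
      rw [BoundedContinuousFunction.dist_eq_iSup, supNorm]
      refine iSup_congr fun t => ?_
      rw [dist_comm, dist_eq_norm]
      simp
    refine ⟨fun k => dist (L (φ k)).1.1 l.1.1, fun k => ?_, ?_⟩
    · have h1 : Tendsto (fun j => dist (u (φ k) (ψ j)).1 l.1.1) atTop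
          (𝓝 (dist (L (φ k)).1.1 l.1.1)) := by
        have h2 := (continuous_fst.tendsto _).comp (hL' (φ k))
        exact ((continuous_subtype_val.tendsto _).comp h2).dist tendsto_const_nhds
      refine h1.congr' ?_
      filter_upwards [hψ.tendsto_atTop.eventually (hX (φ k))] with j hj
      rw [BoundedContinuousFunction.dist_eq_iSup, supNorm]
      refine iSup_congr fun t => ?_
      rw [hu _ _ hj t, hxs t, dist_eq_norm]
    · have h2 := (continuous_fst.tendsto _).comp hl
      have h3 := ((continuous_subtype_val.tendsto _).comp h2).dist
        (tendsto_const_nhds (x := l.1.1))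
      simpa using h3
  · intro h hh
    have heval : Continuous fun c : B => c.1 (hh.toLp h) :=
      (WeakDual.eval_continuous _).comp continuous_subtype_val
    refine ⟨fun k => (L (φ k)).2.1 (hh.toLp h), fun k => ?_, ?_⟩
    · have h2 := (continuous_snd.tendsto _).comp (hL' (φ k))
      refine ((heval.tendsto _).comp h2).congr' ?_
      filter_upwards [hψ.tendsto_atTop.eventually (hY (φ k))] with j hj
      exact hb _ _ hj h hh
    · have h2 := (continuous_snd.tendsto _).comp hl
      have h3 := (heval.tendsto _).comp h2
      have h4 : l.2.1 (hh.toLp h) = ∫ t in (0 : ℝ)..T, inner ℝ (w t) (h t) := by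
        rw [← intervalIntegral_inner_eq hT (Lp.memLp w) hh, Lp.toLp_coeFn]
        exact (InnerProductSpace.toDual_symm_apply).symm
      rw [← h4]
      exact h3

end Compactness

/-! ### Diagonal sequences and almost everywhere convergence. -/

theorem tendsto_of_tendstoUniformlyOn {X E : Type*} [TopologicalSpace X] [UniformSpace E]
    {F : ℕ → X → E} {f : X → E} {K : Set X} (hK : IsClosed K)
    (h : TendstoUniformlyOn F f atTop K) (hf : ContinuousOn f K) {ν : ℕ → ℕ}
    (hν : Tendsto ν atTop atTop) {p : ℕ → X} {a : X} (hp : ∀ k, p k ∈ K)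
    (hlim : Tendsto p atTop (𝓝 a)) : Tendsto (fun k => F (ν k) (p k)) atTop (𝓝 (f a)) := by
  have ha : a ∈ K := hK.mem_of_tendsto hlim (Eventually.of_forall hp)
  have h' : TendstoUniformlyOn (fun k => F (ν k)) f atTop K := fun u hu => hν.eventually (h u hu)
  exact h'.tendsto_comp (hf a ha)
    (tendsto_nhdsWithin_of_tendsto_nhds_of_eventually_within _ hlim (Eventually.of_forall hp))

/-- Diagonal choice in two iterated limits. -/
theorem IteratedLimit.exists_diagonal {a a' : ℕ → ℕ → ℝ} {l l' : ℝ} (h : IteratedLimit a l)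
    (h' : IteratedLimit a' l') {p : ℕ → ℕ → Prop} (hp : ∀ k, ∀ᶠ j in atTop, p k j) :
    ∃ J : ℕ → ℕ, (∀ k, p k (J k)) ∧ Tendsto J atTop atTop ∧
      Tendsto (fun k => a k (J k)) atTop (𝓝 l) ∧
      Tendsto (fun k => a' k (J k)) atTop (𝓝 l') := by
  obtain ⟨b, hab, hb⟩ := h
  obtain ⟨b', hab', hb'⟩ := h'
  have hex : ∀ k : ℕ, ∃ j, p k j ∧ k ≤ j ∧ dist (a k j) (b k) < 1 / ((k : ℝ) + 1) ∧
      dist (a' k j) (b' k) < 1 / ((k : ℝ) + 1) := fun k => by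
    have hk : (0 : ℝ) < 1 / ((k : ℝ) + 1) := by positivity
    exact ((hp k).and ((eventually_ge_atTop k).and ((Metric.tendsto_nhds.1 (hab k) _ hk).and
      (Metric.tendsto_nhds.1 (hab' k) _ hk)))).exists
  choose J hJp hJk hJa hJa' using hex
  have h0 : Tendsto (fun k : ℕ => 1 / ((k : ℝ) + 1)) atTop (𝓝 0) :=
    tendsto_one_div_add_atTop_nhds_zero_nat
  refine ⟨J, hJp, tendsto_atTop_mono hJk tendsto_id, ?_, ?_⟩
  · refine (tendsto_iff_of_dist ?_).2 hb
    exact squeeze_zero (fun _ => dist_nonneg) (fun k => (hJa k).le) h0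
  · refine (tendsto_iff_of_dist ?_).2 hb'
    exact squeeze_zero (fun _ => dist_nonneg) (fun k => (hJa' k).le) h0

theorem norm_le_supNorm {k : ℕ} {T B : ℝ} {u : ℝ → Vec k} (hu : ∀ t ∈ Icc 0 T, ‖u t‖ ≤ B) {t : ℝ}
    (ht : t ∈ Icc 0 T) : ‖u t‖ ≤ supNorm T u :=
  le_ciSup (f := fun t : Icc (0 : ℝ) T => ‖u t‖) ⟨B, by rintro _ ⟨t, rfl⟩; exact hu t t.2⟩ ⟨t, ht⟩

theorem exists_subseq_ae_of_l2Norm {m : ℕ} {T : ℝ} (hT : 0 ≤ T) {y : ℕ → ℝ → Vec m}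
    {w : ℝ → Vec m} (hy : ∀ k, MemLp (y k) 2 (volume.restrict (Icc 0 T)))
    (hw : MemLp w 2 (volume.restrict (Icc 0 T)))
    (hlim : Tendsto (fun k => l2Norm T (fun t => y k t - w t)) atTop (𝓝 0)) :
    ∃ σ : ℕ → ℕ, StrictMono σ ∧
      ∀ᵐ t ∂volume.restrict (Icc 0 T), Tendsto (fun k => y (σ k) t) atTop (𝓝 (w t)) := by
  refine (tendstoInMeasure_of_tendsto_eLpNorm (p := 2) (by simp)
    (fun k => (hy k).aestronglyMeasurable) hw.aestronglyMeasurable ?_).exists_seq_tendsto_ae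
  have he : ∀ k, eLpNorm (y k - w) 2 (volume.restrict (Icc 0 T)) =
      ENNReal.ofReal (l2Norm T (fun t => y k t - w t)) := fun k => by
    rw [((hy k).sub hw).eLpNorm_eq_integral_rpow_norm (by simp) (by simp), l2Norm,
      intervalIntegral.integral_of_le hT, ← integral_Icc_eq_integral_Ioc, Real.sqrt_eq_rpow]
    simp
  simp_rw [he]
  simpa using ENNReal.tendsto_ofReal hlim

/-! ### Passing to the limit in the sampled problems. -/

namespace OCDE

variable {n m q d : ℕ} {D : OCDE n m q d} {π : Measure (Vec d)}

/-- The velocity along a solution is the derivative of a `C¹` function, so no continuity of `f` at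
individual sample points is needed. -/
theorem IsSAASolution.continuousOn_saaF {s : ℕ → Vec d} {ν : ℕ} {ρ : Vec d → ℝ} {μ T₀ : ℝ}
    {x : ℝ → Vec n} {y : ℝ → Vec m} (h : D.IsSAASolution s ν ρ μ T₀ x y) (hT₀ : 0 < T₀) :
    ContinuousOn (fun t => D.saaF s ν t (x t) (y t)) (Icc 0 T₀) :=
  (h.contDiffOn.continuousOn_derivWithin (uniqueDiffOn_Icc hT₀) le_rfl).congr fun t ht =>
    ((h.deriv_eq t ht).derivWithin (uniqueDiffOn_Icc hT₀ t ht)).symm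

theorem IsSAASolution.eq_integral {s : ℕ → Vec d} {ν : ℕ} {ρ : Vec d → ℝ} {μ T₀ : ℝ}
    {x : ℝ → Vec n} {y : ℝ → Vec m} (h : D.IsSAASolution s ν ρ μ T₀ x y) (hT₀ : 0 < T₀) {t : ℝ}
    (ht : t ∈ Icc 0 T₀) : x t = D.x₀ + ∫ τ in (0 : ℝ)..t, D.saaF s ν τ (x τ) (y τ) := by
  have hsub : Icc 0 t ⊆ Icc 0 T₀ := Icc_subset_Icc_right ht.2
  rw [intervalIntegral.integral_eq_sub_of_hasDeriv_right_of_le ht.1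
    (h.contDiffOn.continuousOn.mono hsub)
    (fun τ hτ => (h.hasDerivWithinAt_Ici ⟨hτ.1.le, hτ.2.trans_le ht.2⟩).mono Ioi_subset_Ici_self)
    (((h.continuousOn_saaF hT₀).mono hsub).intervalIntegrable_of_Icc ht.1), h.initial]
  abel

/-- A sequence of bounded solutions of sample average approximations with the sample size tending
to infinity and the regularization parameter tending to zero, converging in `x`. -/
structure ApproxSeq (D : OCDE n m q d) (π : Measure (Vec d)) (ρ : Vec d → ℝ) (s : ℕ → Vec d)
    (T₀ T ε : ℝ) (R : ℕ) (M : NNReal) (ν : ℕ → ℕ) (μ : ℕ → ℝ) (x : ℕ → ℝ → Vec n)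
    (y : ℕ → ℝ → Vec m) (xs : ℝ → Vec n) : Prop where
  size : Tendsto ν atTop atTop
  param : Tendsto μ atTop (𝓝 0)
  solution : ∀ k, D.IsSAASolution s (ν k) ρ (μ k) T₀ (x k) (y k)
  bounded : ∀ k, IsBoundedPair T ε R M D.x₀ (x k) (y k)
  tendsto : ∀ t ∈ Icc 0 T, Tendsto (fun k => x k t) atTop (𝓝 (xs t))

namespace ApproxSeq

variable {ρ : Vec d → ℝ} {s : ℕ → Vec d} {T₀ T ε : ℝ} {R : ℕ} {M : NNReal} {ν : ℕ → ℕ}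
  {μ : ℕ → ℝ} {x : ℕ → ℝ → Vec n} {y : ℕ → ℝ → Vec m} {xs : ℝ → Vec n}

theorem comp (h : D.ApproxSeq π ρ s T₀ T ε R M ν μ x y xs) {σ : ℕ → ℕ}
    (hσ : Tendsto σ atTop atTop) :
    D.ApproxSeq π ρ s T₀ T ε R M (ν ∘ σ) (μ ∘ σ) (x ∘ σ) (y ∘ σ) xs where
  size := h.size.comp hσ
  param := h.param.comp hσ
  solution _ := h.solution _
  bounded _ := h.bounded _
  tendsto t ht := (h.tendsto t ht).comp hσ

/-- Limit points of the approximate minimizers are minimizers. -/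
theorem mem_S (h : D.ApproxSeq π ρ s T₀ T ε R M ν μ x y xs) (hcont : D.ExpectedContinuous π)
    (hs : D.GoodSample π ρ s) (hTT : T ≤ T₀) (hTR : T ≤ R) {y₀ : Vec m}
    (hslater : ∀ t ∈ Icc 0 T, ∀ x, ‖x - D.x₀‖ ≤ ε → ∀ i, D.row π i (t, x, y₀) < 0) {t : ℝ}
    (ht : t ∈ Icc 0 T) {v : Vec m} (hv : Tendsto (fun k => y k t) atTop (𝓝 v)) :
    v ∈ D.S π t (xs t) := by
  have ht0 : t ∈ Icc 0 T₀ := ⟨ht.1, ht.2.trans hTT⟩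
  have hx := h.tendsto t ht
  have hbox : ∀ (R' : ℕ), R ≤ R' → ∀ u : ℕ → Vec m, (∀ k, ‖u k‖ ≤ R') → ∀ k,
      (t, x k t, u k) ∈ box n m R' := fun R' hR' u hu k => by
    have hc : (R : ℝ) ≤ R' := by exact_mod_cast hR'
    exact mem_box.2 ⟨⟨ht.1, (ht.2.trans hTR).trans hc⟩, ((h.bounded k).norm_x t ht).trans hc, hu k⟩
  have hlim : ∀ {u : ℕ → Vec m} {u' : Vec m}, Tendsto u atTop (𝓝 u') →
      Tendsto (fun k => (t, x k t, u k)) atTop (𝓝 (t, xs t, u')) := fun hu =>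
    tendsto_const_nhds.prodMk_nhds (hx.prodMk_nhds hu)
  have hrow : ∀ (R' : ℕ), R ≤ R' → ∀ (u : ℕ → Vec m) (u' : Vec m), (∀ k, ‖u k‖ ≤ R') →
      Tendsto u atTop (𝓝 u') → ∀ i, Tendsto (fun k => D.saaRow s (ν k) i (t, x k t, u k)) atTop
        (𝓝 (D.row π i (t, xs t, u'))) := fun R' hR' u u' hu hlu i =>
    tendsto_of_tendstoUniformlyOn (isCompact_box _).isClosed (hs.tendsto_row R' i)
      ((hcont.row i).mono (box_subset _)) h.size (hbox R' hR' u hu) (hlim hlu)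
  have hobj : ∀ (R' : ℕ), R ≤ R' → ∀ (u : ℕ → Vec m) (u' : Vec m), (∀ k, ‖u k‖ ≤ R') →
      Tendsto u atTop (𝓝 u') → Tendsto (fun k => D.saaObj s (ν k) ρ (μ k) t (x k t) (u k)) atTop
        (𝓝 (D.Eg π t (xs t) u')) := fun R' hR' u u' hu hlu => by
    have h1 := tendsto_of_tendstoUniformlyOn (isCompact_box _).isClosed (hs.tendsto_g R')
      (hcont.g.mono (box_subset _)) h.size (hbox R' hR' u hu) (hlim hlu)
    have h2 := ((h.param.div_const 2).mul (hs.tendsto_weight.comp h.size)).mul (hlu.norm.pow 2)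
    simp only [saaObj_eq]
    simpa using h1.add h2
  have hyR : ∀ k, ‖y k t‖ ≤ R := fun k => (h.bounded k).norm_y t ht
  have hnear : ‖xs t - D.x₀‖ ≤ ε :=
    le_of_tendsto' (hx.sub_const _).norm fun k => (h.bounded k).near t ht
  refine ⟨mem_K.2 fun i => ?_, fun y' hy' => ?_⟩
  · exact le_of_tendsto' (hrow R le_rfl _ v hyR hv i) fun k =>
      mem_saaK.1 ((h.solution k).feasible t ht0) i
  -- A competitor `y'` may be infeasible for the samples. Mixed with the Slater point it is strictly
  -- feasible in the limit, hence eventually feasible for the samples; then `δ` tends to 0.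
  · let c : ℝ → Vec m := fun δ => (1 - δ) • y' + δ • y₀
    have hstep : ∀ δ ∈ Ioc (0 : ℝ) 1, D.Eg π t (xs t) v ≤ D.Eg π t (xs t) (c δ) := by
      intro δ hδ
      obtain ⟨R', hR'⟩ := exists_nat_ge (max (R : ℝ) ‖c δ‖)
      have hR1 : R ≤ R' := by exact_mod_cast (le_max_left _ _).trans hR'
      have hR2 : ‖c δ‖ ≤ R' := (le_max_right _ _).trans hR'
      have hfeas : ∀ᶠ k in atTop, ∀ i, D.saaRow s (ν k) i (t, x k t, c δ) < 0 := by
        refine eventually_all.2 fun i => ?_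
        refine (hrow R' hR1 (fun _ => c δ) (c δ) (fun _ => hR2)
          tendsto_const_nhds i).eventually_lt_const ?_
        have h1 := (convexOn_row (D := D) (π := π) i t (xs t)).2 (mem_univ y') (mem_univ y₀)
          (sub_nonneg.2 hδ.2) hδ.1.le (by ring)
        have h2 := mem_K.1 hy' i
        have h3 := hslater t ht (xs t) hnear i
        simp only [smul_eq_mul] at h1
        have h4 : (1 - δ) * D.row π i (t, xs t, y') ≤ 0 :=
          mul_nonpos_of_nonneg_of_nonpos (sub_nonneg.2 hδ.2) h2
        have h5 : δ * D.row π i (t, xs t, y₀) < 0 := mul_neg_of_pos_of_neg hδ.1 h3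
        exact h1.trans_lt (by linarith)
      refine le_of_tendsto_of_tendsto (hobj R le_rfl _ v hyR hv)
        (hobj R' hR1 (fun _ => c δ) (c δ) (fun _ => hR2) tendsto_const_nhds) ?_
      filter_upwards [hfeas] with k hk
      exact (h.solution k).optimal t ht0 _ (mem_saaK.2 fun i => (hk i).le)
    have hcc : Continuous fun δ => D.Eg π t (xs t) (c δ) :=
      hcont.g.comp_continuous (f := fun δ => (t, xs t, c δ)) (by fun_prop)
        fun _ => ⟨ht.1, mem_univ _⟩
    have hc0 := (hcc.tendsto 0).mono_left (nhdsWithin_le_nhds (s := Ioi 0))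
    have hc00 : c 0 = y' := by simp [c]
    rw [hc00] at hc0
    refine ge_of_tendsto hc0 ?_
    filter_upwards [Ioc_mem_nhdsGT (zero_lt_one (α := ℝ))] with δ hδ using hstep δ hδ

/-- At a fixed time the bounded minimizers have a limit point, so only the convergence of `x` is
needed. -/
theorem S_nonempty (h : D.ApproxSeq π ρ s T₀ T ε R M ν μ x y xs) (hcont : D.ExpectedContinuous π)
    (hs : D.GoodSample π ρ s) (hTT : T ≤ T₀) (hTR : T ≤ R) {y₀ : Vec m}
    (hslater : ∀ t ∈ Icc 0 T, ∀ x, ‖x - D.x₀‖ ≤ ε → ∀ i, D.row π i (t, x, y₀) < 0) {t : ℝ}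
    (ht : t ∈ Icc 0 T) : (D.S π t (xs t)).Nonempty := by
  obtain ⟨v, -, σ, hσ, hv⟩ := (isCompact_closedBall (0 : Vec m) (R : ℝ)).tendsto_subseq
    (x := fun k => y k t) fun k => by simpa using (h.bounded k).norm_y t ht
  exact ⟨v, (h.comp hσ.tendsto_atTop).mem_S hcont hs hTT hTR hslater ht hv⟩

/-- The integral equation passes to the limit. -/
theorem integral_eq (h : D.ApproxSeq π ρ s T₀ T ε R M ν μ x y xs) (hT₀ : 0 < T₀)
    (hcont : D.ExpectedContinuous π) (hs : D.GoodSample π ρ s) (hTT : T ≤ T₀) (hTR : T ≤ R)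
    {w : ℝ → Vec m} (hw : ∀ᵐ t ∂volume.restrict (Icc 0 T),
      Tendsto (fun k => y k t) atTop (𝓝 (w t))) {t : ℝ} (ht : t ∈ Icc 0 T) :
    xs t = D.x₀ + ∫ τ in (0 : ℝ)..t, D.Ef π τ (xs τ) (w τ) := by
  obtain ⟨B, hB⟩ := (isCompact_box (n := n) (m := m) (R : ℝ)).exists_bound_of_continuousOn
    (hcont.f.mono (box_subset _))
  have hbox : ∀ τ ∈ Icc 0 T, ∀ k, (τ, x k τ, y k τ) ∈ box n m R := fun τ hτ k =>
    mem_box.2 ⟨⟨hτ.1, hτ.2.trans hTR⟩, (h.bounded k).norm_x τ hτ, (h.bounded k).norm_y τ hτ⟩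
  have hsub : uIoc 0 t ⊆ Icc 0 T := by
    rw [uIoc_of_le ht.1]
    exact Ioc_subset_Icc_self.trans (Icc_subset_Icc_right ht.2)
  have hlim : Tendsto (fun k => ∫ τ in (0 : ℝ)..t, D.saaF s (ν k) τ (x k τ) (y k τ)) atTop
      (𝓝 (∫ τ in (0 : ℝ)..t, D.Ef π τ (xs τ) (w τ))) := by
    refine intervalIntegral.tendsto_integral_filter_of_dominated_convergence (fun _ => B + 1)
      (Eventually.of_forall fun k => ?_) ?_ intervalIntegrable_const ?_
    · exact (((h.solution k).continuousOn_saaF hT₀).mono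
        (hsub.trans (Icc_subset_Icc_right hTT))).aestronglyMeasurable measurableSet_uIoc
    · filter_upwards [h.size.eventually (hs.eventually_isClose R one_pos)] with k hk
      refine Eventually.of_forall fun τ hτ => ?_
      have h1 := hk.f _ (hbox τ (hsub hτ) k)
      have h2 := hB _ (hbox τ (hsub hτ) k)
      simp only at h1 h2
      have h3 := norm_add_le (D.saaF s (ν k) τ (x k τ) (y k τ) - D.Ef π τ (x k τ) (y k τ))
        (D.Ef π τ (x k τ) (y k τ))
      rw [sub_add_cancel] at h3
      linarith
    · filter_upwards [(ae_restrict_iff' measurableSet_Icc).1 hw] with τ hτ hτt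
      exact tendsto_of_tendstoUniformlyOn (isCompact_box _).isClosed (hs.tendsto_f R)
        (hcont.f.mono (box_subset _)) h.size (hbox τ (hsub hτt))
        (tendsto_const_nhds.prodMk_nhds ((h.tendsto τ (hsub hτt)).prodMk_nhds (hτ (hsub hτt))))
  refine tendsto_nhds_unique (h.tendsto t ht) ((hlim.const_add D.x₀).congr fun k => ?_)
  exact ((h.solution k).eq_integral hT₀ ⟨ht.1, ht.2.trans hTT⟩).symm

end ApproxSeq

end OCDE

/-! ### Optimality at every time and assembly of the limit. -/

/-- A function that lies almost everywhere in given nonempty sets can be modified on a null set so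
as to lie in them everywhere. -/
theorem exists_ae_eq_forall_mem {E : Type*} {η : Measure ℝ} {I : Set ℝ} {S : ℝ → Set E}
    (hS : ∀ t ∈ I, (S t).Nonempty) (w : ℝ → E) :
    ∃ w' : ℝ → E, w' =ᵐ[η] w ∧ ((∀ᵐ t ∂η, w t ∈ S t) → ∀ t ∈ I, w' t ∈ S t) := by
  classical
  -- `w'` must exist before it is known that `w` is optimal almost everywhere; if it is not, `w`
  -- itself serves.
  by_cases h : ∀ᵐ t ∂η, w t ∈ S t
  · refine ⟨fun t => if ht : (S t).Nonempty ∧ w t ∉ S t then ht.1.some else w t, ?_, ?_⟩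
    · filter_upwards [h] with t ht
      simp [ht]
    · intro _ t ht
      by_cases hw : w t ∈ S t
      · simp [hw]
      · simpa [hw, hS t ht] using (hS t ht).some_mem
  · exact ⟨w, EventuallyEq.rfl, fun h' => absurd h' h⟩

theorem IteratedWeakLimit.congr_ae {m : ℕ} {T : ℝ} (hT : 0 ≤ T) {v : ℕ → ℕ → ℝ → Vec m}
    {w w' : ℝ → Vec m} (h : IteratedWeakLimit T v w)
    (hw : w' =ᵐ[volume.restrict (Icc 0 T)] w) : IteratedWeakLimit T v w' := by
  intro g hg
  have he : ∫ t in (0 : ℝ)..T, inner ℝ (w' t) (g t) = ∫ t in (0 : ℝ)..T, inner ℝ (w t) (g t) := by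
    rw [intervalIntegral.integral_of_le hT, intervalIntegral.integral_of_le hT,
      ← integral_Icc_eq_integral_Ioc, ← integral_Icc_eq_integral_Ioc]
    refine integral_congr_ae ?_
    filter_upwards [hw] with t ht
    rw [ht]
  rw [he]
  exact h g hg

namespace OCDE

variable {n m q d : ℕ} {D : OCDE n m q d} {π : Measure (Vec d)}

/-- The statement of the main theorem along a single good realization of the sample. -/
theorem exists_limit_of_goodSample (hcont : D.ExpectedContinuous π) {ρ : Vec d → ℝ}
    {s : ℕ → Vec d} (hs : D.GoodSample π ρ s) {T₀ T ε : ℝ} {R : ℕ} {M : NNReal} (hT : 0 < T)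
    (hTT : T ≤ T₀) (hTR : T ≤ R) {y₀ : Vec m}
    (hslater : ∀ t ∈ Icc 0 T, ∀ x, ‖x - D.x₀‖ ≤ ε → ∀ i, D.row π i (t, x, y₀) < 0)
    {μ : ℕ → ℝ} (hμ : StrictAnti μ) (hμpos : ∀ k, 0 < μ k) (hμ0 : Tendsto μ atTop (𝓝 0))
    {x : ℝ → ℕ → ℝ → Vec n} {y : ℝ → ℕ → ℝ → Vec m}
    (hsol : ∀ k, ∀ᶠ ν : ℕ in atTop, D.IsSAASolution s ν ρ (μ k) T₀ (x (μ k) ν) (y (μ k) ν) ∧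
      IsBoundedPair T ε R M D.x₀ (x (μ k) ν) (y (μ k) ν)) :
    ∃ (xs : ℝ → Vec n) (ys : ℝ → Vec m) (μ : ℕ → ℝ) (ν : ℕ → ℕ),
      AbsolutelyContinuousOnInterval xs 0 T ∧
      MemLp ys 2 (volume.restrict (Icc 0 T)) ∧
      StrictAnti μ ∧ (∀ k, 0 < μ k) ∧ Tendsto μ atTop (𝓝 0) ∧
      Tendsto ν atTop atTop ∧
      IteratedLimit (fun k j => supNorm T (fun t => x (μ k) (ν j) t - xs t)) 0 ∧
      IteratedWeakLimit T (fun k j => y (μ k) (ν j)) ys ∧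
      (IteratedLimit (fun k j => l2Norm T (fun t => y (μ k) (ν j) t - ys t)) 0 →
        D.IsWeakSolution π T xs ys) := by
  have hT₀ : 0 < T₀ := hT.trans_le hTT
  obtain ⟨φ, ψ, hφ, hψ, xs, w, hxs, hw, hlimx, hlimy⟩ := exists_iterated_subseq (R := R) (M := M)
    hT.le R.cast_nonneg (fun k j => x (μ k) j) (fun k j => y (μ k) j)
    (fun k => (hsol k).mono fun j hj => ⟨hj.2.norm_x, hj.2.lipschitz⟩)
    (fun k => (hsol k).mono fun j hj =>
      ⟨hj.2.norm_y, hj.1.continuousOn.mono (Icc_subset_Icc_right hTT)⟩)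
  obtain ⟨B, hB⟩ := isCompact_Icc.exists_bound_of_continuousOn hxs.continuousOn
  have hev : ∀ k, ∀ᶠ j in atTop,
      D.IsSAASolution s (ψ j) ρ (μ (φ k)) T₀ (x (μ (φ k)) (ψ j)) (y (μ (φ k)) (ψ j)) ∧
      IsBoundedPair T ε R M D.x₀ (x (μ (φ k)) (ψ j)) (y (μ (φ k)) (ψ j)) := fun k =>
    hψ.tendsto_atTop.eventually (hsol (φ k))
  have happrox : ∀ J : ℕ → ℕ, (∀ k, D.IsSAASolution s (ψ (J k)) ρ (μ (φ k)) T₀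
        (x (μ (φ k)) (ψ (J k))) (y (μ (φ k)) (ψ (J k))) ∧
        IsBoundedPair T ε R M D.x₀ (x (μ (φ k)) (ψ (J k))) (y (μ (φ k)) (ψ (J k)))) →
      Tendsto J atTop atTop →
      Tendsto (fun k => supNorm T (fun t => x (μ (φ k)) (ψ (J k)) t - xs t)) atTop (𝓝 0) →
      D.ApproxSeq π ρ s T₀ T ε R M (fun k => ψ (J k)) (fun k => μ (φ k))
        (fun k => x (μ (φ k)) (ψ (J k))) (fun k => y (μ (φ k)) (ψ (J k))) xs := by
    intro J hJ hJt hJx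
    refine ⟨hψ.tendsto_atTop.comp hJt, hμ0.comp hφ.tendsto_atTop, fun k => (hJ k).1,
      fun k => (hJ k).2, fun t ht => ?_⟩
    refine tendsto_iff_norm_sub_tendsto_zero.2 (squeeze_zero (fun _ => norm_nonneg _)
      (fun k => ?_) hJx)
    -- The real supremum of an unbounded family is 0 by default, so a bound is required first.
    refine norm_le_supNorm (B := R + B) (u := fun t => x (μ (φ k)) (ψ (J k)) t - xs t)
      (fun τ hτ => ?_) ht
    exact (norm_sub_le _ _).trans (add_le_add ((hJ k).2.norm_x τ hτ) (hB τ hτ))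
  have hne : ∀ t ∈ Icc 0 T, (D.S π t (xs t)).Nonempty := by
    obtain ⟨J, hJ, hJt, hJx, -⟩ := hlimx.exists_diagonal hlimx hev
    exact fun t ht => (happrox J hJ hJt hJx).S_nonempty hcont hs hTT hTR hslater ht
  obtain ⟨ys, hys, hysS⟩ := exists_ae_eq_forall_mem (η := volume.restrict (Icc 0 T)) hne w
  have hysL : MemLp ys 2 (volume.restrict (Icc 0 T)) := hw.ae_eq hys.symm
  have hac : AbsolutelyContinuousOnInterval xs 0 T := by
    refine LipschitzOnWith.absolutelyContinuousOnInterval (K := M) ?_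
    rwa [uIcc_of_le hT.le]
  refine ⟨xs, ys, fun k => μ (φ k), ψ, hac, hysL, hμ.comp_strictMono hφ, fun k => hμpos _,
    hμ0.comp hφ.tendsto_atTop, hψ.tendsto_atTop, hlimx, hlimy.congr_ae hT.le hys, fun hstrong => ?_⟩
  -- One diagonal serves both the uniform convergence of `x` and the strong convergence of `y`.
  obtain ⟨J, hJ, hJt, hJx, hJy⟩ := hlimx.exists_diagonal hstrong hev
  have happ := happrox J hJ hJt hJx
  have hyL : ∀ k, MemLp (y (μ (φ k)) (ψ (J k))) 2 (volume.restrict (Icc 0 T)) := fun k =>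
    MemLp.of_bound (((hJ k).1.continuousOn.mono
      (Icc_subset_Icc_right hTT)).aestronglyMeasurable measurableSet_Icc) R
      ((ae_restrict_iff' measurableSet_Icc).2 (Eventually.of_forall (hJ k).2.norm_y))
  obtain ⟨σ, hσ, hae⟩ := exists_subseq_ae_of_l2Norm hT.le hyL hysL hJy
  have happσ := happ.comp hσ.tendsto_atTop
  refine ⟨hac, hysL.integrable one_le_two, hysS ?_, fun t ht =>
    happσ.integral_eq hT₀ hcont hs hTT hTR hae ht⟩
  filter_upwards [hae, hys, ae_restrict_mem measurableSet_Icc] with t h1 h2 h3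
  rw [← h2]
  exact happσ.mem_S hcont hs hTT hTR hslater h3 h1

end OCDE

end

theorem mainTheorem10 {n m q d : ℕ} (D : OCDE n m q d)
    {Ω : Type*} [MeasurableSpace Ω] (P : Measure Ω) [IsProbabilityMeasure P]
    -- the random vector and an i.i.d. sample of it
    (ξ : Ω → Vec d) (hξ : Measurable ξ)
    (ξs : ℕ → Ω → Vec d) (hindep : iIndepFun ξs P) (hident : ∀ l, IdentDistrib (ξs l) ξ P P)
    -- the assumptions on the data
    (hD : D.Standing (P.map ξ)) (hA : D.InteriorAssumption (P.map ξ))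
    (hrow : D.NoActiveTrivialRow (P.map ξ))
    -- the weight of the regularization term
    (ρ : Vec d → ℝ) (hρm : Measurable ρ) (hρpos : ∀ z, 0 < ρ z) (hρi : Integrable ρ (P.map ξ))
    -- the solutions of the regularized sample average approximations
    (T₀ : ℝ) (hT₀ : 0 < T₀)
    (x : ℝ → ℕ → Ω → ℝ → Vec n) (y : ℝ → ℕ → Ω → ℝ → Vec m)
    (hsol : ∀ μ : ℝ, 0 < μ → ∀ᵐ ω ∂P, ∀ᶠ ν : ℕ in atTop,
      D.IsSAASolution (fun l => ξs l ω) ν ρ μ T₀ (x μ ν ω) (y μ ν ω)) :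
    ∃ T : ℝ, 0 < T ∧ T ≤ T₀ ∧ ∀ᵐ ω ∂P,
      ∃ (xs : ℝ → Vec n) (ys : ℝ → Vec m) (μ : ℕ → ℝ) (ν : ℕ → ℕ),
        AbsolutelyContinuousOnInterval xs 0 T ∧
        MemLp ys 2 (volume.restrict (Icc 0 T)) ∧
        StrictAnti μ ∧ (∀ k, 0 < μ k) ∧ Tendsto μ atTop (𝓝 0) ∧
        Tendsto ν atTop atTop ∧
        IteratedLimit (fun k j => supNorm T (fun t => x (μ k) (ν j) ω t - xs t)) 0 ∧
        IteratedWeakLimit T (fun k j => y (μ k) (ν j) ω) ys ∧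
        (IteratedLimit (fun k j => l2Norm T (fun t => y (μ k) (ν j) ω t - ys t)) 0 →
          D.IsWeakSolution (P.map ξ) T xs ys) := by
  have hcont := OCDE.expectedContinuous hD hindep hident
  obtain ⟨T, hT, hTT, y₀, ε, R, M, hTR, hslater, hbound⟩ :=
    OCDE.exists_bounds hcont hA hrow hρpos hT₀
  refine ⟨T, hT, hTT, ?_⟩
  -- A countable family of parameters, so the null sets of `hsol` can be united; all are at most 1,
  -- as the bounds require.
  let μ₀ : ℕ → ℝ := fun k => 1 / ((k : ℝ) + 1)
  have hμpos : ∀ k, 0 < μ₀ k := fun k => by positivity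
  have hμle : ∀ k, μ₀ k ≤ 1 := fun k => by
    refine (div_le_one (by positivity)).2 ?_
    have : (0 : ℝ) ≤ k := k.cast_nonneg
    linarith
  have hμanti : StrictAnti μ₀ := fun k l hkl => by
    refine one_div_lt_one_div_of_lt (by positivity) ?_
    have : (k : ℝ) < l := by exact_mod_cast hkl
    linarith
  have hμ0 : Tendsto μ₀ atTop (𝓝 0) := tendsto_one_div_add_atTop_nhds_zero_nat
  filter_upwards [OCDE.ae_goodSample hD hindep hident hρm hρi,
    ae_all_iff.2 fun k => hsol (μ₀ k) (hμpos k)] with ω hs hω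
  refine OCDE.exists_limit_of_goodSample (M := M) (x := fun μ ν => x μ ν ω) (y := fun μ ν => y μ ν ω)
    hcont hs hT hTT hTR hslater hμanti hμpos hμ0 fun k => ?_
  filter_upwards [hω k, hbound _ hs] with ν h1 h2
  exact ⟨h1, h2 _ (hμpos k) (hμle k) _ _ h1⟩
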